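/- Let $\mathbb F$ be a finite field, let $M,L,n,k$ be non-negative integers with $n\ge 1$ and $L\le M/2$, let $\alpha=k/n$, and assume $0\le\alpha\le 2$. Put $q=\max(n,k)$ and let $\mathbf G$ be the $q\times q$ down-shift matrix over $\mathbb F$, i.e. $(\mathbf G\mathbf x)_1=0$ and $(\mathbf G\mathbf x)_{l+1}=\mathbf x_l$. In the symmetric two-user parallel linear deterministic interference channel with $M$ subcarriers, transmitter $i\in\{1,2\}$ sends at time $t\in\{1,\dots,N\}$ a vector $\mathbf x^i_j(t)\in\mathbb F^q$ on each subcarrier $j\in\{1,\dots,M\}$. Receiver $i$ observes, on subcarrier $j$, $$\mathbf y^i_j(t)=\mathbf G^{q-n}\mathbf x^i_j(t)+\mathbf G^{q-k}\mathbf x^{i'}_j(t)\ \ (i'\neq i)\qquad\text{or}\qquad \mathbf y^i_j(t)=\mathbf G^{q-n}\mathbf x^i_j(t)$$ according to whether its subcarrier $j$ is interfered or interference free. The set of interfered subcarriers of each receiver is constant over the $N$ channel uses, known to that receiver, and unknown to the transmitters. User $i$ has independent uniformly distributed messages $W^i_0,W^i_L,W^i_M$ of rates $R_0,R_L,R_M\ge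 0$ (the same for both users, measured in symbols of $\mathbb F$ per channel use, so that a message of rate $R$ takes $\lceil|\mathbb F|^{NR}\rceil$ values), the messages of the two users being independent; transmitter $i$ encodes its messages into $(\mathbf x^i_j(t))_{j,t}$. Receiver $i$ must decode $W^i_M$ when all its $M$ subcarriers are interfered; $(W^i_L,W^i_M)$ when any $L$ of its $M$ subcarriers are interfered (for every choice of the $L$ subcarriers); and $(W^i_0,W^i_L,W^i_M)$ when none is interfered. A rate triple is achievable if there are codes of block lengths $N=1,2,\dots$ for which all these decoding error probabilities tend to $0$ as $N\to\infty$. The capacity region of the $(R_0,R_L,0)$-setup is the closure of the set of pairs $(R_0,R_L)$ such that $(R_0,R_L,0)$ is achievable. Then this capacity region is exactly the set of all pairs $(R_0,R_L)$ with $R_0\ge 0$, $R_L\ge 0$, $$M R_L+(M-L)R_0\le M\bigl((M-2L)+L(\max(1,\alpha)+\max(1-\alpha,0))\bigr)n,$$ $$R_L+R_0\le Mn.$$ -/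

import Mathlib

open Filter Topology Matrix

namespace BurstyIC

/-- The `q × q` down-shift matrix: `(G x) 0 = 0` and `(G x) (l + 1) = x l`;
level `0` is the top (most significant) level. -/
def shift (F : Type*) [Field F] (q : ℕ) : Matrix (Fin q) (Fin q) F :=
  Matrix.of fun a b => if (a : ℕ) = (b : ℕ) + 1 then 1 else 0

/-- A signal block over `N` time slots and `M` subcarriers, each symbol being a vector
in `F ^ q` with `q = max n k`. -/
abbrev Signal (F : Type*) (M n k N : ℕ) : Type _ :=
  Fin N → Fin M → Fin (max n k) → F

/-- The block received by a user whose own transmitter sends `x` while the other transmitter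
sends `x'`, when exactly the subcarriers in `S` are interfered (during the whole block). -/
def received {F : Type*} [Field F] {M n k N : ℕ} (S : Finset (Fin M))
    (x x' : Signal F M n k N) : Signal F M n k N := fun t j =>
  if j ∈ S then
    (shift F (max n k) ^ (max n k - n)) *ᵥ (x t j)
      + (shift F (max n k) ^ (max n k - k)) *ᵥ (x' t j)
  else
    (shift F (max n k) ^ (max n k - n)) *ᵥ (x t j)

/-- The message triple `(W₀, W_L, W_M)` of one user. -/
abbrev Msg (m₀ mL mM : ℕ) : Type := Fin m₀ × Fin mL × Fin mM

/-- A block code of length `N` for the two users. The encoders do not know which subcarriers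
are interfered; each receiver does know it for its own subcarriers. -/
structure Code (F : Type*) (M n k N m₀ mL mM : ℕ) where
  /-- encoder of transmitter `i` -/
  enc : Fin 2 → Msg m₀ mL mM → Signal F M n k N
  /-- decoder of receiver `i` for `W_M`, all subcarriers interfered -/
  decAll : Fin 2 → Signal F M n k N → Fin mM
  /-- decoder of receiver `i` for `(W_L, W_M)`, subcarriers in the given set interfered -/
  decSome : Fin 2 → Finset (Fin M) → Signal F M n k N → Fin mL × Fin mM
  /-- decoder of receiver `i` for `(W₀, W_L, W_M)`, no subcarrier interfered -/
  decFree : Fin 2 → Signal F M n k N → Msg m₀ mL mM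

namespace Code

variable {F : Type*} [Field F] {M n k N m₀ mL mM : ℕ}

/-- What receiver `i` gets when the users' message triples are `w 0` and `w 1` and the
subcarriers in `S` are interfered at this receiver (`i.rev` is the other user). -/
def output (C : Code F M n k N m₀ mL mM) (i : Fin 2) (S : Finset (Fin M))
    (w : Fin 2 → Msg m₀ mL mM) : Signal F M n k N :=
  received S (C.enc i (w i)) (C.enc i.rev (w i.rev))

/-- The probability of an event when the messages of both users are independent and uniform. -/
noncomputable def msgProb (E : Set (Fin 2 → Msg m₀ mL mM)) : ℝ :=
  (E.ncard : ℝ) / (Fintype.card (Fin 2 → Msg m₀ mL mM) : ℝ)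

/-- Probability that receiver `i` errs on `W_M` when all its subcarriers are interfered. -/
noncomputable def errAll (C : Code F M n k N m₀ mL mM) (i : Fin 2) : ℝ :=
  msgProb {w : Fin 2 → Msg m₀ mL mM | C.decAll i (C.output i Finset.univ w) ≠ (w i).2.2}

/-- Probability that receiver `i` errs on `(W_L, W_M)` when its subcarriers in `S` are
interfered. -/
noncomputable def errSome (C : Code F M n k N m₀ mL mM) (i : Fin 2) (S : Finset (Fin M)) : ℝ :=
  msgProb {w : Fin 2 → Msg m₀ mL mM | C.decSome i S (C.output i S w) ≠ (w i).2}

/-- Probability that receiver `i` errs on `(W₀, W_L, W_M)` when none of its subcarriers is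
interfered. -/
noncomputable def errFree (C : Code F M n k N m₀ mL mM) (i : Fin 2) : ℝ :=
  msgProb {w : Fin 2 → Msg m₀ mL mM | C.decFree i (C.output i ∅ w) ≠ w i}

end Code

/-- Number of messages of rate `R` at block length `N`; rates are measured in symbols of `F`
per channel use, i.e. logarithms are to base `|F|`. -/
noncomputable def numMsg (F : Type*) [Fintype F] (R : ℝ) (N : ℕ) : ℕ :=
  ⌈(Fintype.card F : ℝ) ^ ((N : ℝ) * R)⌉₊

/-- The symmetric rate triple `(R₀, R_L, R_M)` is achievable: some sequence of codes, one for
each block length `N`, has vanishing error probability in each of the decoding requirements,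
for both receivers and for every set of `L` interfered subcarriers. -/
def Achievable (F : Type*) [Field F] [Fintype F] (M L n k : ℕ) (R₀ RL RM : ℝ) : Prop :=
  0 ≤ R₀ ∧ 0 ≤ RL ∧ 0 ≤ RM ∧
  ∃ C : ∀ N : ℕ, Code F M n k N (numMsg F R₀ N) (numMsg F RL N) (numMsg F RM N),
    ∀ i : Fin 2,
      Tendsto (fun N => (C N).errAll i) atTop (𝓝 0) ∧
      (∀ S : Finset (Fin M), S.card = L → Tendsto (fun N => (C N).errSome i S) atTop (𝓝 0)) ∧
      Tendsto (fun N => (C N).errFree i) atTop (𝓝 0)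

/-- The capacity region of the `(R₀, R_L, 0)`-setup: the closure of the set of achievable
pairs `(R₀, R_L)` when `R_M = 0`. -/
def capacityRegion (F : Type*) [Field F] [Fintype F] (M L n k : ℕ) : Set (ℝ × ℝ) :=
  closure {p : ℝ × ℝ | Achievable F M L n k p.1 p.2 0}

end BurstyIC

/-! Random variables on the finite set of message pairs are represented by their kernel partitions:
a finer partition carries more information, and `⊓` is the joint variable.

Converse. The sum bound is Fano's inequality for the interference-free receiver, which sees `M * n`
symbols per channel use. For the weighted bound, let `S` be a set of `L` interfered subcarriers.
Once receiver `i` knows its own messages, its output reveals the other user's interference on `S`,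
which is independent of those messages. Hence H(W_L, clean signal off S) + H(interference of the
other user on S) is at most H(output), up to a Fano term (`ent_message_clean_add_le`). The output
entropy is at most `L * max n k` symbols plus the clean entropy off `S`. As `2 * L ≤ M`, the
complement of `S` contains another `L`-set `T`, and the clean entropy off `S` is bounded by
H(interference of user i on T) plus a symbol count (`ent_clean_compl_le`). Let `S` run over the `M`
cyclic windows and `T` be the next window. Shearer's inequality bounds the clean terms below by M
H(W_L) + (M - L) H(W_0), and adding the two users cancels all interference terms
(`weighted_log_card_le`).

Achievability. Only the top `n` levels are used. Of these, `d = min k (2 * n - k)` can be hit by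
interference and `n - d` cannot. W_L is sent uncoded on safe levels and, if they do not suffice, on
exposed levels through an erasure code across subcarriers that survives the loss of any `L` of them;
W_0 fills what is left (`exists_zeroError_code`). The split in `exists_level_shares` matches both
outer bounds, so every scaled-down pair is achievable and the closure gives the region. -/

namespace BurstyIC

/-! ### Entropy of partitions of a finite uniform space. -/

section Entropy

variable {Ω : Type*} [Fintype Ω]

open Classical in
/-- The number of elements of the class of `ω`. -/
noncomputable def classCard (r : Setoid Ω) (ω : Ω) : ℕ :=
  (Finset.univ.filter fun a => r a ω).card

/-- The Shannon entropy (in nats) of the partition `r` of a finite set with its uniform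
distribution. -/
noncomputable def ent (r : Setoid Ω) : ℝ :=
  Real.log (Fintype.card Ω) - (∑ ω, Real.log (classCard r ω)) / Fintype.card Ω

theorem classCard_pos (r : Setoid Ω) (ω : Ω) : 0 < classCard r ω := by
  classical
  exact Finset.card_pos.2 ⟨ω, by simp⟩

theorem classCard_congr {r : Setoid Ω} {a b : Ω} (h : r a b) : classCard r a = classCard r b := by
  classical
  unfold classCard
  congr 1
  ext x
  simp only [Finset.mem_filter, Finset.mem_univ, true_and]
  exact ⟨fun hx => r.trans hx h, fun hx => r.trans hx (r.symm h)⟩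

theorem classCard_mono {r s : Setoid Ω} (h : r ≤ s) (ω : Ω) : classCard r ω ≤ classCard s ω := by
  classical
  refine Finset.card_le_card fun x hx => ?_
  simp only [Finset.mem_filter, Finset.mem_univ, true_and] at hx ⊢
  exact h hx

theorem ent_anti {r s : Setoid Ω} (h : r ≤ s) : ent s ≤ ent r := by
  unfold ent
  refine sub_le_sub_left (div_le_div_of_nonneg_right (Finset.sum_le_sum fun ω _ => ?_)
    (Nat.cast_nonneg _)) _
  exact Real.log_le_log (by exact_mod_cast classCard_pos r ω) (by exact_mod_cast classCard_mono h ω)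

/-- The reciprocals of the class sizes over a subset of a single class add up to at most one. -/
theorem sum_inv_classCard_le_one (r : Setoid Ω) (s : Finset Ω)
    (h : ∀ a ∈ s, ∀ b ∈ s, r a b) : ∑ ω ∈ s, (classCard r ω : ℝ)⁻¹ ≤ 1 := by
  classical
  rcases s.eq_empty_or_nonempty with rfl | hs
  · simp
  have hpos : (0 : ℝ) < s.card := by exact_mod_cast hs.card_pos
  calc ∑ ω ∈ s, (classCard r ω : ℝ)⁻¹ ≤ ∑ ω ∈ s, (s.card : ℝ)⁻¹ := by
        refine Finset.sum_le_sum fun ω hω => inv_anti₀ hpos ?_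
        have : s.card ≤ classCard r ω := Finset.card_le_card fun a ha => by
          simpa using h a ha ω hω
        exact_mod_cast this
    _ = 1 := by
        rw [Finset.sum_const, nsmul_eq_mul]
        exact mul_inv_cancel₀ hpos.ne'

theorem sum_inv_classCard_class_le_one (r : Setoid Ω) (a : Ω) [DecidableRel r] :
    ∑ ω ∈ Finset.univ.filter (fun ω => r ω a), (classCard r ω : ℝ)⁻¹ ≤ 1 :=
  sum_inv_classCard_le_one r _ fun b hb c hc => by
    simp only [Finset.mem_filter, Finset.mem_univ, true_and] at hb hc
    exact r.trans hb (r.symm hc)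

open Classical in
theorem classCard_cast (r : Setoid Ω) (ω : Ω) :
    (classCard r ω : ℝ) = ∑ a, if r a ω then 1 else 0 := by
  simp [classCard]

/-- Nonnegativity of conditional mutual information given `t`. Apply log x ≤ x - 1 to the ratio of
class sizes |r||s| / (|r ⊓ s||t|). The ratios sum to at most |Ω|: expand |r||s| as a count of pairs
`a`, `b`; for a fixed pair, the points `ω` concerned lie in one class of `r ⊓ s` and force `t b a`.
-/
theorem ent_submodular {r s t : Setoid Ω} (hr : r ≤ t) (hs : s ≤ t) :
    ent (r ⊓ s) + ent t ≤ ent r + ent s := by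
  classical
  have key : ∑ ω, (classCard r ω : ℝ) * classCard s ω * ((classCard (r ⊓ s) ω : ℝ)⁻¹ *
      (classCard t ω : ℝ)⁻¹) ≤ Fintype.card Ω := by
    calc _ = ∑ a, ∑ b, ∑ ω, (if r a ω ∧ s b ω then
              (classCard (r ⊓ s) ω : ℝ)⁻¹ * (classCard t ω : ℝ)⁻¹ else 0) := by
            rw [Finset.sum_congr rfl fun ω _ => by
              rw [classCard_cast r, classCard_cast s, Finset.sum_mul_sum, Finset.sum_mul]]
            rw [Finset.sum_comm]
            refine Finset.sum_congr rfl fun a _ => ?_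
            rw [Finset.sum_congr rfl fun ω _ => Finset.sum_mul _ _ _, Finset.sum_comm]
            refine Finset.sum_congr rfl fun b _ => Finset.sum_congr rfl fun ω _ => ?_
            by_cases h1 : r a ω <;> by_cases h2 : s b ω <;> simp [h1, h2]
      _ ≤ ∑ a, ∑ b, (if t b a then (classCard t b : ℝ)⁻¹ else 0) := by
            refine Finset.sum_le_sum fun a _ => Finset.sum_le_sum fun b _ => ?_
            rw [← Finset.sum_filter]
            set p := Finset.univ.filter fun ω => r a ω ∧ s b ω with hp
            have hmem : ∀ ω, ω ∈ p ↔ r a ω ∧ s b ω := by simp [hp]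
            rcases p.eq_empty_or_nonempty with he | ⟨c, hc⟩
            · rw [he, Finset.sum_empty]
              split_ifs <;> positivity
            have hc' := (hmem c).1 hc
            rw [if_pos (t.trans (hs hc'.2) (t.symm (hr hc'.1)))]
            have : ∀ ω ∈ p, (classCard (r ⊓ s) ω : ℝ)⁻¹ * (classCard t ω : ℝ)⁻¹ =
                (classCard (r ⊓ s) ω : ℝ)⁻¹ * (classCard t b : ℝ)⁻¹ := fun ω hω => by
              rw [classCard_congr (hs ((hmem ω).1 hω).2)]
            rw [Finset.sum_congr rfl this, ← Finset.sum_mul]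
            refine mul_le_of_le_one_left (by positivity) (sum_inv_classCard_le_one _ _ ?_)
            intro x hx y hy
            have hx' := (hmem x).1 hx
            have hy' := (hmem y).1 hy
            exact ⟨r.trans (r.symm hx'.1) hy'.1, s.trans (s.symm hx'.2) hy'.2⟩
      _ ≤ ∑ a : Ω, (1 : ℝ) := by
            refine Finset.sum_le_sum fun a _ => ?_
            rw [← Finset.sum_filter]
            exact sum_inv_classCard_class_le_one t a
      _ = Fintype.card Ω := by simp
  have hlog : ∑ ω, (Real.log (classCard r ω) + Real.log (classCard s ω)
      - Real.log (classCard (r ⊓ s) ω) - Real.log (classCard t ω)) ≤ 0 := by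
    calc _ ≤ ∑ ω, ((classCard r ω : ℝ) * classCard s ω * ((classCard (r ⊓ s) ω : ℝ)⁻¹ *
          (classCard t ω : ℝ)⁻¹) - 1) := by
            refine Finset.sum_le_sum fun ω _ => ?_
            have h1 : (0 : ℝ) < classCard r ω := by exact_mod_cast classCard_pos r ω
            have h2 : (0 : ℝ) < classCard s ω := by exact_mod_cast classCard_pos s ω
            have h3 : (0 : ℝ) < classCard (r ⊓ s) ω := by exact_mod_cast classCard_pos _ ω
            have h4 : (0 : ℝ) < classCard t ω := by exact_mod_cast classCard_pos t ω
            refine le_trans (le_of_eq ?_) (Real.log_le_sub_one_of_pos (by positivity))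
            rw [Real.log_mul (by positivity) (by positivity), Real.log_mul h1.ne' h2.ne',
              Real.log_mul (by positivity) (by positivity), Real.log_inv, Real.log_inv]
            ring
      _ ≤ 0 := by
            rw [Finset.sum_sub_distrib]
            simpa using key
  simp only [Finset.sum_sub_distrib, Finset.sum_add_distrib] at hlog
  unfold ent
  have : ((∑ ω, Real.log (classCard r ω)) + (∑ ω, Real.log (classCard s ω))
      - (∑ ω, Real.log (classCard (r ⊓ s) ω)) - ∑ ω, Real.log (classCard t ω)) /
      (Fintype.card Ω : ℝ) ≤ 0 := div_nonpos_of_nonpos_of_nonneg (by linarith) (by positivity)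
  rw [sub_div, sub_div, add_div] at this
  linarith

/-- Gibbs' inequality for the conditional entropy of `r ⊓ s` given `s`. -/
theorem ent_inf_le_of_sum_le (r s : Setoid Ω) (f : Ω → ℝ) (hf : ∀ ω, 0 < f ω)
    (h : ∑ ω, (classCard s ω : ℝ) * (classCard (r ⊓ s) ω : ℝ)⁻¹ * f ω ≤ Fintype.card Ω) :
    ent (r ⊓ s) ≤ ent s + (∑ ω, -Real.log (f ω)) / Fintype.card Ω := by
  have hlog : ∑ ω, (Real.log (classCard s ω) - Real.log (classCard (r ⊓ s) ω)
      - -Real.log (f ω)) ≤ 0 := by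
    calc _ ≤ ∑ ω, ((classCard s ω : ℝ) * (classCard (r ⊓ s) ω : ℝ)⁻¹ * f ω - 1) := by
            refine Finset.sum_le_sum fun ω _ => ?_
            have h2 : (0 : ℝ) < classCard s ω := by exact_mod_cast classCard_pos s ω
            have h3 : (0 : ℝ) < classCard (r ⊓ s) ω := by exact_mod_cast classCard_pos _ ω
            have h4 := hf ω
            refine le_trans (le_of_eq ?_) (Real.log_le_sub_one_of_pos (by positivity))
            rw [Real.log_mul (by positivity) h4.ne', Real.log_mul h2.ne' (by positivity),
              Real.log_inv]
            ring
      _ ≤ 0 := by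
            rw [Finset.sum_sub_distrib]
            simpa using h
  rw [Finset.sum_sub_distrib, Finset.sum_sub_distrib] at hlog
  have := div_nonpos_of_nonpos_of_nonneg hlog (Nat.cast_nonneg (α := ℝ) (Fintype.card Ω))
  rw [sub_div, sub_div] at this
  unfold ent
  linarith

open Classical in
theorem sum_classCard_div (r s : Setoid Ω) (p : Finset Ω) :
    ∑ ω ∈ p, (classCard s ω : ℝ) * (classCard (r ⊓ s) ω : ℝ)⁻¹ =
      ∑ a, ∑ ω ∈ p.filter (fun ω => s a ω), (classCard (r ⊓ s) ω : ℝ)⁻¹ := by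
  rw [Finset.sum_congr rfl fun ω _ => by rw [classCard_cast s, Finset.sum_mul], Finset.sum_comm]
  refine Finset.sum_congr rfl fun a _ => ?_
  rw [Finset.sum_filter]
  refine Finset.sum_congr rfl fun ω _ => ?_
  split_ifs <;> simp

/-- Inside one class of `s`, each value of `f` cuts out a subset of a single class of the meet,
which contributes at most 1. -/
theorem sum_classCard_ker_div_le {β : Type*} [Fintype β] (f : Ω → β) (s : Setoid Ω) :
    ∑ ω, (classCard s ω : ℝ) * (classCard (Setoid.ker f ⊓ s) ω : ℝ)⁻¹ ≤
      Fintype.card Ω * Fintype.card β := by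
  classical
  rw [sum_classCard_div]
  calc _ ≤ ∑ a : Ω, (Fintype.card β : ℝ) := by
        refine Finset.sum_le_sum fun a _ => ?_
        rw [← Finset.sum_fiberwise_of_maps_to (t := Finset.univ) (g := f) (by simp)]
        calc _ ≤ ∑ b : β, (1 : ℝ) := by
              refine Finset.sum_le_sum fun b _ => sum_inv_classCard_le_one _ _ ?_
              intro x hx y hy
              simp only [Finset.mem_filter, Finset.mem_univ, true_and] at hx hy
              exact ⟨hx.2.trans hy.2.symm, s.trans (s.symm hx.1) hy.1⟩
          _ = _ := by simp
    _ = _ := by simp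

theorem ent_ker_inf_le [Nonempty Ω] {β : Type*} [Fintype β] (f : Ω → β) (s : Setoid Ω) :
    ent (Setoid.ker f ⊓ s) ≤ ent s + Real.log (Fintype.card β) := by
  have : Nonempty β := ⟨f (Classical.arbitrary Ω)⟩
  have hβ : (0 : ℝ) < Fintype.card β := by exact_mod_cast Fintype.card_pos
  have hΩ : (0 : ℝ) < Fintype.card Ω := by exact_mod_cast Fintype.card_pos
  have := ent_inf_le_of_sum_le (Setoid.ker f) s (fun _ => (Fintype.card β : ℝ)⁻¹)
    (fun _ => by positivity) (by
      rw [← Finset.sum_mul]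
      calc _ ≤ (Fintype.card Ω * Fintype.card β : ℝ) * (Fintype.card β : ℝ)⁻¹ :=
            mul_le_mul_of_nonneg_right (sum_classCard_ker_div_le f s) (by positivity)
        _ ≤ _ := by rw [mul_assoc, mul_inv_cancel₀ hβ.ne', mul_one])
  simp only [Real.log_inv, neg_neg, Finset.sum_const, Finset.card_univ, nsmul_eq_mul] at this
  rwa [mul_div_cancel_left₀ _ hΩ.ne'] at this

/-- Fano's inequality. -/
theorem ent_ker_inf_ker_le_fano [Nonempty Ω] {β γ : Type*} [Fintype β] (W : Ω → β) (Y : Ω → γ)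
    (g : γ → β) :
    ent (Setoid.ker W ⊓ Setoid.ker Y) ≤ ent (Setoid.ker Y) + (Real.log 2 +
      ({ω | g (Y ω) ≠ W ω}.ncard : ℝ) / Fintype.card Ω * Real.log (Fintype.card β)) := by
  classical
  have : Nonempty β := ⟨W (Classical.arbitrary Ω)⟩
  have hβ : (0 : ℝ) < Fintype.card β := by exact_mod_cast Fintype.card_pos
  have hΩ : (0 : ℝ) < Fintype.card Ω := by exact_mod_cast Fintype.card_pos
  set s := Setoid.ker Y with hs
  -- Trial conditional law for Gibbs: half the mass on the guess, half spread over `β`. It costs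
  -- `log 2` always and `log |β|` only upon an error.
  set f : Ω → ℝ := fun ω => if g (Y ω) = W ω then 2⁻¹ else 2⁻¹ * (Fintype.card β : ℝ)⁻¹ with hf
  have h1 : ∑ ω ∈ Finset.univ.filter (fun ω => g (Y ω) = W ω),
      (classCard s ω : ℝ) * (classCard (Setoid.ker W ⊓ s) ω : ℝ)⁻¹ ≤ Fintype.card Ω := by
    rw [sum_classCard_div]
    calc _ ≤ ∑ a : Ω, (1 : ℝ) := by
          refine Finset.sum_le_sum fun a _ => sum_inv_classCard_le_one _ _ ?_
          intro x hx y hy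
          simp only [Finset.mem_filter, Finset.mem_univ, true_and] at hx hy
          refine ⟨?_, s.trans (s.symm hx.2) hy.2⟩
          have e1 : Y a = Y x := hx.2
          have e2 : Y a = Y y := hy.2
          change W x = W y
          rw [← hx.1, ← hy.1, ← e1, ← e2]
      _ = _ := by simp
  have h2 : ∑ ω ∈ Finset.univ.filter (fun ω => ¬ g (Y ω) = W ω),
      (classCard s ω : ℝ) * (classCard (Setoid.ker W ⊓ s) ω : ℝ)⁻¹ ≤
      Fintype.card Ω * Fintype.card β :=
    (Finset.sum_le_sum_of_subset_of_nonneg (Finset.filter_subset _ _)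
      fun _ _ _ => by positivity).trans (sum_classCard_ker_div_le W s)
  have main := ent_inf_le_of_sum_le (Setoid.ker W) s f
    (fun ω => by simp only [hf]; split_ifs <;> positivity) (by
      rw [← Finset.sum_filter_add_sum_filter_not _ (fun ω => g (Y ω) = W ω)]
      have e1 : ∑ ω ∈ Finset.univ.filter (fun ω => g (Y ω) = W ω),
          (classCard s ω : ℝ) * (classCard (Setoid.ker W ⊓ s) ω : ℝ)⁻¹ * f ω =
          (∑ ω ∈ Finset.univ.filter (fun ω => g (Y ω) = W ω),
          (classCard s ω : ℝ) * (classCard (Setoid.ker W ⊓ s) ω : ℝ)⁻¹) * 2⁻¹ := by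
        rw [Finset.sum_mul]
        refine Finset.sum_congr rfl fun ω hω => ?_
        simp only [Finset.mem_filter, Finset.mem_univ, true_and] at hω
        simp only [hf, if_pos hω]
      have e2 : ∑ ω ∈ Finset.univ.filter (fun ω => ¬ g (Y ω) = W ω),
          (classCard s ω : ℝ) * (classCard (Setoid.ker W ⊓ s) ω : ℝ)⁻¹ * f ω =
          (∑ ω ∈ Finset.univ.filter (fun ω => ¬ g (Y ω) = W ω),
          (classCard s ω : ℝ) * (classCard (Setoid.ker W ⊓ s) ω : ℝ)⁻¹) *
            (2⁻¹ * (Fintype.card β : ℝ)⁻¹) := by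
        rw [Finset.sum_mul]
        refine Finset.sum_congr rfl fun ω hω => ?_
        simp only [Finset.mem_filter, Finset.mem_univ, true_and] at hω
        simp only [hf, if_neg hω]
      rw [e1, e2]
      have h2' := mul_le_mul_of_nonneg_right h2 (by positivity :
        (0 : ℝ) ≤ 2⁻¹ * (Fintype.card β : ℝ)⁻¹)
      have : (Fintype.card Ω * Fintype.card β : ℝ) * (2⁻¹ * (Fintype.card β : ℝ)⁻¹) =
          Fintype.card Ω * 2⁻¹ := by field_simp
      linarith)
  refine main.trans (add_le_add_right ?_ _)
  have e3 : ∑ ω, -Real.log (f ω) = Fintype.card Ω * Real.log 2 +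
      ({ω | g (Y ω) ≠ W ω}.ncard : ℝ) * Real.log (Fintype.card β) := by
    have : ∀ ω, -Real.log (f ω) = Real.log 2 +
        if g (Y ω) ≠ W ω then Real.log (Fintype.card β) else 0 := fun ω => by
      by_cases h : g (Y ω) = W ω
      · simp [hf, h]
      · simp only [hf, if_neg h, ne_eq, h, not_false_eq_true, if_true]
        rw [Real.log_mul (by positivity) (by positivity), Real.log_inv, Real.log_inv]
        ring
    rw [Finset.sum_congr rfl fun ω _ => this ω, Finset.sum_add_distrib, ← Finset.sum_filter,
      Finset.sum_const, Finset.sum_const, nsmul_eq_mul, nsmul_eq_mul, Finset.card_univ,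
      ← Set.ncard_coe_finset]
    simp
  rw [e3, add_div, mul_div_cancel_left₀ _ hΩ.ne']
  exact le_of_eq (by ring)

theorem ent_eq_of_classCard_eq [Nonempty Ω] {r : Setoid Ω} {c : ℕ}
    (h : ∀ ω, classCard r ω = c) : ent r = Real.log (Fintype.card Ω) - Real.log c := by
  have hΩ : (0 : ℝ) < Fintype.card Ω := by exact_mod_cast Fintype.card_pos
  unfold ent
  simp only [h, Finset.sum_const, Finset.card_univ, nsmul_eq_mul]
  rw [mul_div_cancel_left₀ _ hΩ.ne']

/-- The hypothesis is independence of the two partitions, stated by counting. -/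
theorem ent_inf_eq_add [Nonempty Ω] {r s : Setoid Ω}
    (h : ∀ ω, classCard (r ⊓ s) ω * Fintype.card Ω = classCard r ω * classCard s ω) :
    ent (r ⊓ s) = ent r + ent s := by
  have hΩ : (0 : ℝ) < Fintype.card Ω := by exact_mod_cast Fintype.card_pos
  have : ∀ ω, Real.log (classCard (r ⊓ s) ω) =
      Real.log (classCard r ω) + Real.log (classCard s ω) - Real.log (Fintype.card Ω) := by
    intro ω
    have h1 : (classCard r ω : ℝ) ≠ 0 := by exact_mod_cast (classCard_pos r ω).ne'
    have h2 : (classCard s ω : ℝ) ≠ 0 := by exact_mod_cast (classCard_pos s ω).ne'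
    have h3 : (classCard (r ⊓ s) ω : ℝ) ≠ 0 := by exact_mod_cast (classCard_pos _ ω).ne'
    rw [← Real.log_mul h1 h2, eq_sub_iff_add_eq, ← Real.log_mul h3 hΩ.ne']
    congr 1
    exact_mod_cast h ω
  unfold ent
  rw [Finset.sum_congr rfl fun ω _ => this ω]
  simp only [Finset.sum_sub_distrib, Finset.sum_add_distrib, Finset.sum_const, Finset.card_univ,
    nsmul_eq_mul]
  rw [sub_div, add_div, mul_div_cancel_left₀ _ hΩ.ne']
  ring

end Entropy

/-! ### Shearer's inequality. -/

/-- Shearer's inequality for a submodular set function. -/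
theorem shearer {M : ℕ} {ι : Type*} [Fintype ι] (f : Finset (Fin M) → ℝ)
    (hf : ∀ A B, f (A ∪ B) + f (A ∩ B) ≤ f A + f B) (S : ι → Finset (Fin M)) (c : ℕ)
    (hc : ∀ j, (Finset.univ.filter fun s => j ∈ S s).card = c) :
    (Fintype.card ι : ℝ) * f ∅ + c * (f Finset.univ - f ∅) ≤ ∑ s, f (S s) := by
  classical
  -- Chain rule along initial segments: by submodularity the increment from adding `j` to `P m` is
  -- at most the one from adding it to `S s ∩ P m`, and `j` lies in exactly `c` of the sets.
  set P : ℕ → Finset (Fin M) := fun m => Finset.univ.filter fun j => (j : ℕ) < m with hP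
  have step : ∀ m ≤ M, (Fintype.card ι : ℝ) * f ∅ + c * (f (P m) - f ∅) ≤ ∑ s, f (S s ∩ P m) := by
    intro m
    induction m with
    | zero => intro _; simp [hP]
    | succ m ih =>
      intro hm
      have hm' : m < M := hm
      set j : Fin M := ⟨m, hm'⟩ with hj
      have hins : P (m + 1) = insert j (P m) := by
        ext x
        simp only [hP, hj, Finset.mem_filter, Finset.mem_univ, true_and, Finset.mem_insert,
          Fin.ext_iff]
        omega
      have hjn : j ∉ P m := by simp [hP, hj]
      have hs : ∀ s, (if j ∈ S s then f (P (m + 1)) - f (P m) else 0) ≤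
          f (S s ∩ P (m + 1)) - f (S s ∩ P m) := by
        intro s
        split_ifs with h
        · have h0 := hf (S s ∩ P (m + 1)) (P m)
          have e1 : S s ∩ P (m + 1) ∪ P m = P (m + 1) := by
            rw [hins]; ext x
            simp only [Finset.mem_union, Finset.mem_inter, Finset.mem_insert]
            constructor
            · tauto
            · rintro (rfl | hx) <;> tauto
          have e2 : S s ∩ P (m + 1) ∩ P m = S s ∩ P m := by
            rw [hins]; ext x
            simp only [Finset.mem_inter, Finset.mem_insert]
            tauto
          rw [e1, e2] at h0
          linarith
        · rw [hins, Finset.inter_insert_of_notMem h]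
          simp
      have hsum := Finset.sum_le_sum fun s (_ : s ∈ Finset.univ) => hs s
      rw [← Finset.sum_filter, Finset.sum_const, hc, nsmul_eq_mul, Finset.sum_sub_distrib] at hsum
      have := ih hm'.le
      linarith
  have hPM : P M = Finset.univ := by ext x; simp [hP]
  simpa [hPM] using step M le_rfl

/-! ### Powers of the shift, and entropy of families of subcarrier signals. -/

theorem shift_mulVec_apply (F : Type*) [Field F] (q : ℕ) (x : Fin q → F) (r : Fin q) :
    (shift F q *ᵥ x) r = if h : 1 ≤ (r : ℕ) then x ⟨r - 1, by omega⟩ else 0 := by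
  simp only [shift, Matrix.mulVec, dotProduct, Matrix.of_apply, ite_mul, one_mul, zero_mul]
  split_ifs with h
  · rw [Finset.sum_eq_single ⟨(r : ℕ) - 1, by omega⟩]
    · rw [if_pos (by simp only []; omega)]
    · intro b _ hb
      rw [if_neg]
      intro hr
      exact hb (Fin.ext (by simp only []; omega))
    · simp
  · refine Finset.sum_eq_zero fun b _ => if_neg (by omega)

theorem shift_pow_mulVec_apply (F : Type*) [Field F] (q a : ℕ) (x : Fin q → F) (r : Fin q) :
    (shift F q ^ a *ᵥ x) r = if h : a ≤ (r : ℕ) then x ⟨r - a, by omega⟩ else 0 := by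
  induction a generalizing r with
  | zero => simp
  | succ a ih =>
    rw [pow_succ', ← Matrix.mulVec_mulVec, shift_mulVec_apply]
    by_cases h : 1 ≤ (r : ℕ)
    · rw [dif_pos h, ih]
      by_cases h' : a + 1 ≤ (r : ℕ)
      · rw [dif_pos (by simp only []; omega), dif_pos h']
        congr 2
        simp only []
        omega
      · rw [dif_neg (by simp only []; omega), dif_neg h']
    · rw [dif_neg h, dif_neg (by omega)]

section Parts

variable {Ω β : Type*} {M : ℕ}

/-- The partition generated by the variables `X j`, `j ∈ S`. -/
def part (X : Fin M → Ω → β) (S : Finset (Fin M)) : Setoid Ω :=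
  Setoid.ker fun ω (j : S) => X j ω

theorem part_iff {X : Fin M → Ω → β} {S : Finset (Fin M)} {a b : Ω} :
    part X S a b ↔ ∀ j ∈ S, X j a = X j b := by
  unfold part
  rw [Setoid.ker_def]
  constructor
  · intro h j hj
    exact congrFun h ⟨j, hj⟩
  · intro h
    funext j
    exact h j j.2

/-- Joining `t` to every term gives the conditional form that Shearer needs, with W_L as the
condition. -/
theorem ent_part_submodular [Fintype Ω] (X : Fin M → Ω → β) (t : Setoid Ω)
    (A B : Finset (Fin M)) :
    ent (t ⊓ part X (A ∪ B)) + ent (t ⊓ part X (A ∩ B)) ≤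
      ent (t ⊓ part X A) + ent (t ⊓ part X B) := by
  have h := ent_submodular (r := t ⊓ part X A) (s := t ⊓ part X B) (t := t ⊓ part X (A ∩ B))
    (fun {x y} h => ⟨h.1, part_iff.2 fun j hj => part_iff.1 h.2 j (Finset.mem_inter.1 hj).1⟩)
    (fun {x y} h => ⟨h.1, part_iff.2 fun j hj => part_iff.1 h.2 j (Finset.mem_inter.1 hj).2⟩)
  refine le_trans (add_le_add_left (ent_anti ?_) _) h
  intro x y hxy
  refine ⟨hxy.1.1, part_iff.2 fun j hj => ?_⟩
  rcases Finset.mem_union.1 hj with hj | hj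
  · exact part_iff.1 hxy.1.2 j hj
  · exact part_iff.1 hxy.2.2 j hj

end Parts

/-- Conditioning on a block of field symbols costs at most its length. -/
theorem ent_symbols_inf_le {Ω F : Type*} [Fintype Ω] [Nonempty Ω] [Fintype F] {M N p : ℕ}
    (S : Finset (Fin M)) (f : Ω → S → Fin N → Fin p → F) (s : Setoid Ω) :
    ent (Setoid.ker f ⊓ s) ≤ ent s + S.card * p * N * Real.log (Fintype.card F) := by
  refine (ent_ker_inf_le f s).trans (le_of_eq ?_)
  simp only [Fintype.card_pi, Finset.prod_const, Finset.card_univ, Fintype.card_fin,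
    Fintype.card_coe, Nat.cast_pow, Real.log_pow]
  ring

/-! ### Independence of the two users' messages. -/

section Pairs

variable {α : Type*} [Fintype α]

theorem card_filter_and (i : Fin 2) (P R : α → Prop) [DecidablePred P] [DecidablePred R] :
    (Finset.univ.filter fun w : Fin 2 → α => P (w i) ∧ R (w i.rev)).card =
      (Finset.univ.filter P).card * (Finset.univ.filter R).card := by
  classical
  rw [← Finset.card_product]
  refine Finset.card_bij' (fun w _ => (w i, w i.rev))
    (fun p _ j => if j = i then p.1 else p.2) ?_ ?_ ?_ ?_
  · intro w hw
    simpa using hw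
  · intro p hp
    have : i.rev ≠ i := by fin_cases i <;> decide
    simpa [this] using hp
  · intro w _
    funext j
    fin_cases i <;> fin_cases j <;> simp
  · intro p _
    have : i.rev ≠ i := by fin_cases i <;> decide
    simp [this]

theorem card_filter_apply (i : Fin 2) (P : α → Prop) [DecidablePred P] :
    (Finset.univ.filter fun w : Fin 2 → α => P (w i)).card =
      (Finset.univ.filter P).card * Fintype.card α := by
  have := card_filter_and i P (fun _ => True)
  simpa using this

theorem card_pairs : Fintype.card (Fin 2 → α) = Fintype.card α * Fintype.card α := by
  simp [sq]

theorem ent_message_inf [Nonempty α] {β : Type*} (i : Fin 2) (g : α → β) :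
    ent (Setoid.ker (fun w : Fin 2 → α => w i) ⊓ Setoid.ker fun w : Fin 2 → α => g (w i.rev)) =
      ent (Setoid.ker fun w : Fin 2 → α => w i) +
        ent (Setoid.ker fun w : Fin 2 → α => g (w i.rev)) := by
  classical
  refine ent_inf_eq_add fun ω => ?_
  have h1 : classCard (Setoid.ker (fun w : Fin 2 → α => w i) ⊓
      Setoid.ker fun w : Fin 2 → α => g (w i.rev)) ω =
      (Finset.univ.filter fun w : Fin 2 → α => w i = ω i ∧ g (w i.rev) = g (ω i.rev)).card := by
    unfold classCard
    congr
  have h2 : classCard (Setoid.ker (fun w : Fin 2 → α => w i)) ω =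
      (Finset.univ.filter fun w : Fin 2 → α => w i = ω i).card := by
    unfold classCard
    congr
  have h3 : classCard (Setoid.ker (fun w : Fin 2 → α => g (w i.rev))) ω =
      (Finset.univ.filter fun w : Fin 2 → α => g (w i.rev) = g (ω i.rev)).card := by
    unfold classCard
    congr
  rw [h1, h2, h3, card_filter_and i (fun a => a = ω i) (fun a => g a = g (ω i.rev)),
    card_filter_apply i (fun a => a = ω i), card_filter_apply i.rev (fun a => g a = g (ω i.rev)),
    card_pairs]
  ring

theorem ent_ker_message [Nonempty α] {β : Type*} [DecidableEq β] (i : Fin 2) (g : α → β) (c : ℕ)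
    (hc : ∀ b, (Finset.univ.filter fun a => g a = g b).card = c) :
    ent (Setoid.ker fun w : Fin 2 → α => g (w i)) = Real.log (Fintype.card α) - Real.log c := by
  have hα : (Fintype.card α : ℝ) ≠ 0 := by exact_mod_cast Fintype.card_ne_zero
  have hcpos : (c : ℝ) ≠ 0 := by
    rw [← hc (Classical.arbitrary α)]
    exact_mod_cast (Finset.card_pos.2 ⟨Classical.arbitrary α, by simp⟩).ne'
  rw [ent_eq_of_classCard_eq (c := c * Fintype.card α), card_pairs]
  · push_cast
    rw [Real.log_mul hα hα, Real.log_mul hcpos hα]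
    ring
  · intro ω
    have h3 : classCard (Setoid.ker (fun w : Fin 2 → α => g (w i))) ω =
        (Finset.univ.filter fun w : Fin 2 → α => g (w i) = g (ω i)).card := by
      unfold classCard
      congr
    rw [h3, card_filter_apply i (fun a => g a = g (ω i)), hc]

end Pairs

/-! ### Cyclic windows of subcarriers. -/

/-- The cyclic window of length `L` starting at `s`. -/
def window {M : ℕ} (L : ℕ) (s : Fin M) : Finset (Fin M) :=
  Finset.univ.filter fun j => ((j - s : Fin M) : ℕ) < L

theorem mem_window {M L : ℕ} {s j : Fin M} : j ∈ window L s ↔ ((j - s : Fin M) : ℕ) < L := by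
  simp [window]

theorem card_fin_lt {M L : ℕ} (h : L ≤ M) :
    (Finset.univ.filter fun x : Fin M => (x : ℕ) < L).card = L := by
  rw [Fin.card_filter_val_lt, min_eq_right h]

theorem card_window {M L : ℕ} [NeZero M] (h : L ≤ M) (s : Fin M) : (window L s).card = L := by
  refine (Finset.card_equiv (Equiv.subRight s) fun j => ?_).trans (card_fin_lt h)
  simp [mem_window]

theorem card_notMem_window {M L : ℕ} [NeZero M] (h : L ≤ M) (j : Fin M) :
    (Finset.univ.filter fun s : Fin M => j ∈ (window L s)ᶜ).card = M - L := by
  have h1 : (Finset.univ.filter fun s : Fin M => j ∈ window L s).card = L := by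
    refine (Finset.card_equiv (Equiv.subLeft j) fun s => ?_).trans (card_fin_lt h)
    simp [mem_window]
  have h2 := Finset.card_filter_add_card_filter_not (s := Finset.univ)
    (fun s : Fin M => j ∈ window L s)
  simp only [Finset.mem_compl]
  rw [h1, Finset.card_univ, Fintype.card_fin] at h2
  omega

theorem window_add_subset_compl {M L : ℕ} [NeZero M] (h : 2 * L ≤ M) (s : Fin M) :
    window L (s + Fin.ofNat M L) ⊆ (window L s)ᶜ := by
  intro j hj
  rw [Finset.mem_compl]
  intro hj'
  rw [mem_window] at hj hj'
  have hM : 0 < M := Nat.pos_of_ne_zero (NeZero.ne M)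
  have hL : 0 < L := by omega
  -- As `j - s` is below `L`, subtracting `L` wraps around to at least `M - L ≥ L`, so `j` is not in
  -- the next window.
  rw [← sub_sub, Fin.coe_sub_iff_lt.2] at hj
  · rw [Fin.val_ofNat, Nat.mod_eq_of_lt (by omega)] at hj
    omega
  · rw [Fin.lt_def, Fin.val_ofNat, Nat.mod_eq_of_lt (by omega)]
    exact hj'

/-! ### Entropy inequalities for a code of fixed block length. -/

namespace Code

variable {F : Type*} [Field F] {M n k N m₀ mL mM : ℕ}

/-- The signal of user `i` on subcarrier `j` as its own receiver sees it without interference. -/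
def clean (C : Code F M n k N m₀ mL mM) (i : Fin 2) (j : Fin M) (w : Fin 2 → Msg m₀ mL mM) :
    Fin N → Fin (max n k) → F :=
  fun t => (shift F (max n k) ^ (max n k - n)) *ᵥ (C.enc i (w i) t j)

/-- The interference that user `i` causes on subcarrier `j` at the other receiver. -/
def interference (C : Code F M n k N m₀ mL mM) (i : Fin 2) (j : Fin M)
    (w : Fin 2 → Msg m₀ mL mM) : Fin N → Fin (max n k) → F :=
  fun t => (shift F (max n k) ^ (max n k - k)) *ᵥ (C.enc i (w i) t j)

theorem output_apply (C : Code F M n k N m₀ mL mM) (i : Fin 2) (S : Finset (Fin M))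
    (w : Fin 2 → Msg m₀ mL mM) (t : Fin N) (j : Fin M) :
    C.output i S w t j =
      if j ∈ S then C.clean i j w t + C.interference i.rev j w t else C.clean i j w t := rfl

variable [NeZero m₀] [NeZero mL] [NeZero mM]

theorem ent_output_le [Fintype F] (C : Code F M n k N m₀ mL mM) (i : Fin 2) (S : Finset (Fin M)) :
    ent (Setoid.ker (C.output i S)) ≤
      ent (part (C.clean i) Sᶜ) + S.card * max n k * N * Real.log (Fintype.card F) := by
  have h := ent_symbols_inf_le S (fun w (j : S) t => C.output i S w t j) (part (C.clean i) Sᶜ)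
  refine le_trans (ent_anti fun {x y} hxy => ?_) h
  funext t j
  by_cases hj : j ∈ S
  · exact congrFun (congrFun hxy.1 ⟨j, hj⟩) t
  · rw [output_apply, output_apply, if_neg hj, if_neg hj]
    exact congrFun (part_iff.1 hxy.2 j (Finset.mem_compl.2 hj)) t

/-- Fano joins (W_L, W_M) to the output at small cost. Submodularity then compares this pair with
the full message of user `i`: both determine (W_L, W_M) and the clean signal off `S`. Given its own
message, receiver `i` can subtract its signal and is left with the interference, which is
independent of that message. -/
theorem ent_message_clean_add_le (C : Code F M n k N m₀ mL mM) (i : Fin 2) (S : Finset (Fin M)) :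
    ent (Setoid.ker (fun w : Fin 2 → Msg m₀ mL mM => (w i).2) ⊓ part (C.clean i) Sᶜ) +
        ent (part (C.interference i.rev) S) ≤
      ent (Setoid.ker (C.output i S)) +
        (Real.log 2 + C.errSome i S * Real.log (mL * mM)) := by
  have hfano := ent_ker_inf_ker_le_fano (fun w : Fin 2 → Msg m₀ mL mM => (w i).2)
    (C.output i S) (C.decSome i S)
  have hsub := ent_submodular (r := Setoid.ker fun w : Fin 2 → Msg m₀ mL mM => w i)
    (s := Setoid.ker (fun w : Fin 2 → Msg m₀ mL mM => (w i).2) ⊓ Setoid.ker (C.output i S))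
    (t := Setoid.ker (fun w : Fin 2 → Msg m₀ mL mM => (w i).2) ⊓ part (C.clean i) Sᶜ)
    (fun {x y} h => by
      have h' : x i = y i := h
      refine ⟨congrArg Prod.snd h', part_iff.2 fun j _ => ?_⟩
      unfold clean
      rw [h'])
    (fun {x y} h => by
      refine ⟨h.1, part_iff.2 fun j hj => ?_⟩
      have h' : C.output i S x = C.output i S y := h.2
      funext t
      have := congrFun (congrFun h' t) j
      rwa [output_apply, output_apply, if_neg (Finset.mem_compl.1 hj),
        if_neg (Finset.mem_compl.1 hj)] at this)
  have hind := ent_message_inf (α := Msg m₀ mL mM) i (fun a (j : S) t =>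
    (shift F (max n k) ^ (max n k - k)) *ᵥ (C.enc i.rev a t j))
  have hle : ent (Setoid.ker (fun w : Fin 2 → Msg m₀ mL mM => w i) ⊓
        part (C.interference i.rev) S) ≤
      ent (Setoid.ker (fun w : Fin 2 → Msg m₀ mL mM => w i) ⊓
        (Setoid.ker (fun w : Fin 2 → Msg m₀ mL mM => (w i).2) ⊓ Setoid.ker (C.output i S))) := by
    refine ent_anti fun {x y} h => ⟨h.1, part_iff.2 fun j hj => ?_⟩
    have h1 : x i = y i := h.1
    have h2 : C.output i S x = C.output i S y := h.2.2
    funext t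
    have h3 := congrFun (congrFun h2 t) j
    rw [output_apply, output_apply, if_pos hj, if_pos hj] at h3
    have h4 : C.clean i j x t = C.clean i j y t := by
      unfold clean
      rw [h1]
    rw [h4] at h3
    exact add_left_cancel h3
  have hpart : part (C.interference i.rev) S = Setoid.ker fun w : Fin 2 → Msg m₀ mL mM =>
      fun (j : S) t => (shift F (max n k) ^ (max n k - k)) *ᵥ (C.enc i.rev (w i.rev) t j) := rfl
  rw [← hpart] at hind
  have herr : ({w : Fin 2 → Msg m₀ mL mM | C.decSome i S (C.output i S w) ≠ (w i).2}.ncard : ℝ) /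
      Fintype.card (Fin 2 → Msg m₀ mL mM) = C.errSome i S := rfl
  rw [herr] at hfano
  simp only [Fintype.card_prod, Fintype.card_fin, Nat.cast_mul] at hfano
  linarith

/-- The interference caused on `T` shows the top `k` levels of the sent vectors and the clean signal
the top `n`. So `n - k` (truncated) symbols are missing on each subcarrier of `T`, and `n` on each
of the remaining `M - 2 * L`. -/
theorem ent_clean_compl_le [Fintype F] (C : Code F M n k N m₀ mL mM) (i : Fin 2) {L : ℕ}
    {S T : Finset (Fin M)} (hS : S.card = L) (hT : T.card = L) (hTS : T ⊆ Sᶜ) :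
    ent (part (C.clean i) Sᶜ) ≤ ent (part (C.interference i) T) +
      ((M - 2 * L) * n + L * (n - k : ℕ)) * N * Real.log (Fintype.card F) := by
  have h1 := ent_symbols_inf_le T
    (fun (w : Fin 2 → Msg m₀ mL mM) (j : T) t (l : Fin (n - k)) =>
      C.enc i (w i) t j ⟨k + l, by omega⟩) (part (C.interference i) T)
  have h2 := ent_symbols_inf_le (Sᶜ \ T)
    (fun (w : Fin 2 → Msg m₀ mL mM) (j : ↥(Sᶜ \ T)) t (l : Fin n) =>
      C.enc i (w i) t j ⟨l, by omega⟩)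
    (Setoid.ker (fun (w : Fin 2 → Msg m₀ mL mM) (j : T) t (l : Fin (n - k)) =>
      C.enc i (w i) t j ⟨k + l, by omega⟩) ⊓ part (C.interference i) T)
  have hcard : ((Sᶜ \ T).card : ℝ) = M - 2 * L := by
    have e1 := Finset.card_sdiff_add_card_eq_card hTS
    have e2 := Finset.card_compl_add_card S
    rw [Fintype.card_fin] at e2
    rw [hT] at e1
    rw [hS] at e2
    have e3 : ((Sᶜ \ T).card : ℝ) + L + L = M := by
      rw [← e1] at e2
      exact_mod_cast e2
    linarith
  rw [hT] at h1
  rw [hcard] at h2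
  have h3 : ent (part (C.clean i) Sᶜ) ≤ ent (Setoid.ker
      (fun (w : Fin 2 → Msg m₀ mL mM) (j : ↥(Sᶜ \ T)) t (l : Fin n) =>
      C.enc i (w i) t j ⟨l, by omega⟩) ⊓ (Setoid.ker
      (fun (w : Fin 2 → Msg m₀ mL mM) (j : T) t (l : Fin (n - k)) =>
      C.enc i (w i) t j ⟨k + l, by omega⟩) ⊓ part (C.interference i) T)) := by
    refine ent_anti fun {x y} h => part_iff.2 fun j hj => ?_
    obtain ⟨ha, hb, hc⟩ := h
    have hsymb : ∀ t (l : Fin (max n k)), (l : ℕ) < n →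
        C.enc i (x i) t j l = C.enc i (y i) t j l := by
      intro t l hl
      by_cases hjT : j ∈ T
      · by_cases hlk : (l : ℕ) < k
        · have := congrFun (congrFun (part_iff.1 hc j hjT) t)
            ⟨(l : ℕ) + (max n k - k), by omega⟩
          unfold interference at this
          rw [shift_pow_mulVec_apply, shift_pow_mulVec_apply, dif_pos (by simp),
            dif_pos (by simp)] at this
          simpa using this
        · have := congrFun (congrFun (congrFun hb ⟨j, hjT⟩) t) ⟨l - k, by omega⟩
          have e : k + ((l : ℕ) - k) = l := by omega
          simpa [e] using this
      · exact congrFun (congrFun (congrFun ha ⟨j, Finset.mem_sdiff.2 ⟨hj, hjT⟩⟩) t) ⟨l, hl⟩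
    funext t r
    unfold clean
    rw [shift_pow_mulVec_apply, shift_pow_mulVec_apply]
    split_ifs with hr
    · exact hsymb t _ (by simp only []; omega)
    · rfl
  linarith

theorem ent_clean_univ_ge (C : Code F M n k N m₀ mL mM) (i : Fin 2) :
    Real.log m₀ + Real.log (mL * mM) ≤ ent (part (C.clean i) Finset.univ) +
      (Real.log 2 + C.errFree i * (Real.log m₀ + Real.log (mL * mM))) := by
  have h0 : (m₀ : ℝ) ≠ 0 := by exact_mod_cast NeZero.ne m₀
  have h1 : (mL : ℝ) ≠ 0 := by exact_mod_cast NeZero.ne mL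
  have h2 : (mM : ℝ) ≠ 0 := by exact_mod_cast NeZero.ne mM
  have hfano := ent_ker_inf_ker_le_fano (fun w : Fin 2 → Msg m₀ mL mM => w i)
    (C.output i ∅) (C.decFree i)
  have herr : ({w : Fin 2 → Msg m₀ mL mM | C.decFree i (C.output i ∅ w) ≠ w i}.ncard : ℝ) /
      Fintype.card (Fin 2 → Msg m₀ mL mM) = C.errFree i := rfl
  have hmsg := ent_ker_message (α := Msg m₀ mL mM) i id 1 fun b => by
    rw [Finset.card_eq_one]
    exact ⟨b, by ext; simp⟩
  have hle : ent (Setoid.ker fun w : Fin 2 → Msg m₀ mL mM => id (w i)) ≤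
      ent (Setoid.ker (fun w : Fin 2 → Msg m₀ mL mM => w i) ⊓ Setoid.ker (C.output i ∅)) :=
    ent_anti inf_le_left
  have hout : ent (Setoid.ker (C.output i ∅)) ≤ ent (part (C.clean i) Finset.univ) := by
    refine ent_anti fun {x y} h => ?_
    funext t j
    exact congrFun (part_iff.1 h j (Finset.mem_univ j)) t
  rw [herr] at hfano
  simp only [Fintype.card_prod, Fintype.card_fin, Nat.cast_mul, Nat.cast_one, Real.log_one,
    sub_zero] at hfano hmsg
  rw [Real.log_mul h0 (by positivity)] at hfano hmsg
  linarith

theorem ent_ker_message_snd (i : Fin 2) :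
    ent (Setoid.ker fun w : Fin 2 → Msg m₀ mL mM => (w i).2) = Real.log (mL * mM) := by
  have h0 : (m₀ : ℝ) ≠ 0 := by exact_mod_cast NeZero.ne m₀
  have h1 : (mL : ℝ) ≠ 0 := by exact_mod_cast NeZero.ne mL
  have h2 : (mM : ℝ) ≠ 0 := by exact_mod_cast NeZero.ne mM
  rw [ent_ker_message (α := Msg m₀ mL mM) i Prod.snd m₀]
  · simp only [Fintype.card_prod, Fintype.card_fin, Nat.cast_mul]
    rw [Real.log_mul h0 (by positivity)]
    ring
  · intro b
    have : (Finset.univ.filter fun a : Msg m₀ mL mM => a.2 = b.2) =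
        Finset.univ ×ˢ {b.2} := by
      ext a
      simp only [Finset.mem_filter, Finset.mem_univ, true_and, Finset.mem_product,
        Finset.mem_singleton]
    rw [this, Finset.card_product]
    simp

theorem log_card_le [Fintype F] (C : Code F M n k N m₀ mL mM) (i : Fin 2) :
    Real.log m₀ + Real.log (mL * mM) ≤ M * n * N * Real.log (Fintype.card F) +
      (Real.log 2 + C.errFree i * (Real.log m₀ + Real.log (mL * mM))) := by
  have h1 := C.ent_clean_univ_ge i
  -- With no interfered subcarrier the bound reduces to counting `M * n * N` symbols.
  have h2 := C.ent_clean_compl_le i (S := ∅) (T := ∅) (L := 0) rfl rfl (by simp)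
  rw [Finset.compl_empty] at h2
  have h3 : ent (part (C.interference i) ∅) = 0 := by
    have hpart : part (C.interference i) ∅ = Setoid.ker fun w : Fin 2 → Msg m₀ mL mM => () := by
      ext x y
      rw [part_iff]
      simp [Setoid.ker_def]
    rw [hpart, ent_eq_of_classCard_eq (c := Fintype.card (Fin 2 → Msg m₀ mL mM)), sub_self]
    intro ω
    simp [classCard, Setoid.ker_def]
  rw [h3] at h2
  push_cast at h2
  linarith

/-- The entropy form of the weighted sum-rate bound, before letting the block length grow. -/
theorem weighted_log_card_le [Fintype F] [NeZero M] (C : Code F M n k N m₀ mL mM) {L : ℕ} (hL : 2 * L ≤ M) :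
    2 * (M * Real.log (mL * mM) + (M - L) * Real.log m₀) ≤
      2 * M * (((M - 2 * L) * n + L * (max n k + (n - k : ℕ))) * N *
        Real.log (Fintype.card F)) +
      ∑ i : Fin 2, (∑ s : Fin M, (Real.log 2 + C.errSome i (window L s) * Real.log (mL * mM)) +
        (M - L) * (Real.log 2 + C.errFree i * (Real.log m₀ + Real.log (mL * mM)))) := by
  have hLM : L ≤ M := by omega
  have hLM' : (L : ℝ) ≤ M := by exact_mod_cast hLM
  let c : Fin M := Fin.ofNat M L
  have hper : ∀ i : Fin 2, M * Real.log (mL * mM) + (M - L) * Real.log m₀ +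
      ∑ s : Fin M, ent (part (C.interference i.rev) (window L s)) ≤
      ∑ s : Fin M, ent (part (C.interference i) (window L s)) +
      M * (((M - 2 * L) * n + L * (max n k + (n - k : ℕ))) * N * Real.log (Fintype.card F)) +
      (∑ s : Fin M, (Real.log 2 + C.errSome i (window L s) * Real.log (mL * mM)) +
        (M - L) * (Real.log 2 + C.errFree i * (Real.log m₀ + Real.log (mL * mM)))) := by
    intro i
    -- The value at `∅` is the entropy of (W_L, W_M), so it gets weight `M`, while what W_0 adds
    -- gets weight `M - L`, the number of windows missing a given subcarrier.
    have hsh := shearer (fun A => ent (Setoid.ker (fun w : Fin 2 → Msg m₀ mL mM => (w i).2) ⊓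
      part (C.clean i) A)) (ent_part_submodular _ _) (fun s : Fin M => (window L s)ᶜ) (M - L)
      (fun j => card_notMem_window hLM j)
    have hempty : ent (Setoid.ker (fun w : Fin 2 → Msg m₀ mL mM => (w i).2) ⊓
        part (C.clean i) ∅) = Real.log (mL * mM) := by
      rw [← ent_ker_message_snd (m₀ := m₀) i]
      congr 1
      refine inf_eq_left.2 fun {x y} _ => part_iff.2 fun j hj => ?_
      simp at hj
    have huniv : ent (part (C.clean i) Finset.univ) ≤
        ent (Setoid.ker (fun w : Fin 2 → Msg m₀ mL mM => (w i).2) ⊓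
        part (C.clean i) Finset.univ) := ent_anti inf_le_right
    have hfree := C.ent_clean_univ_ge i
    have hmul := mul_le_mul_of_nonneg_left (hfree.trans (add_le_add_left huniv _))
      (sub_nonneg.2 hLM')
    simp only [hempty, Fintype.card_fin, Nat.cast_sub hLM] at hsh
    have hs : ∀ s : Fin M, ent (Setoid.ker (fun w : Fin 2 → Msg m₀ mL mM => (w i).2) ⊓
        part (C.clean i) (window L s)ᶜ) + ent (part (C.interference i.rev) (window L s)) ≤
        ent (part (C.interference i) (window L (s + c))) +
        ((M - 2 * L) * n + L * (max n k + (n - k : ℕ))) * N * Real.log (Fintype.card F) +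
        (Real.log 2 + C.errSome i (window L s) * Real.log (mL * mM)) := by
      intro s
      have a1 := C.ent_message_clean_add_le i (window L s)
      have a2 := C.ent_output_le i (window L s)
      have a3 := C.ent_clean_compl_le i (card_window hLM s) (card_window hLM (s + c))
        (window_add_subset_compl hL s)
      rw [card_window hLM] at a2
      linarith
    have hsum := Finset.sum_le_sum fun s (_ : s ∈ Finset.univ) => hs s
    simp only [Finset.sum_add_distrib] at hsum
    -- Moving to the next window permutes the windows, so the interference sums are over the same
    -- family.
    have hcomp := Equiv.sum_comp (Equiv.addRight c)
      (fun s => ent (part (C.interference i) (window L s)))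
    simp only [Equiv.coe_addRight] at hcomp
    rw [hcomp] at hsum
    simp only [Finset.sum_const, Finset.card_univ, Fintype.card_fin, nsmul_eq_mul] at hsum
    simp only [Finset.sum_add_distrib, Finset.sum_const, Finset.card_univ, Fintype.card_fin,
      nsmul_eq_mul]
    linarith
  -- In `hper` each user's interference sum is on the right for that user and on the left for the
  -- other; adding cancels them.
  have h0 := hper 0
  have h1 := hper 1
  rw [Fin.sum_univ_two]
  have e0 : (0 : Fin 2).rev = 1 := rfl
  have e1 : (1 : Fin 2).rev = 0 := rfl
  rw [e0] at h0
  rw [e1] at h1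
  linarith

end Code

/-! ### Size of the message sets. -/

section NumMsg

variable (F : Type*) [Fintype F]

theorem two_le_card [Field F] : (2 : ℝ) ≤ Fintype.card F := by
  exact_mod_cast Fintype.one_lt_card (α := F)

theorem log_card_pos [Field F] : 0 < Real.log (Fintype.card F) :=
  Real.log_pos (by linarith [two_le_card F])

instance numMsg_neZero [Field F] (R : ℝ) (N : ℕ) : NeZero (numMsg F R N) :=
  ⟨(Nat.ceil_pos.2 (Real.rpow_pos_of_pos (by linarith [two_le_card F]) _)).ne'⟩

theorem numMsg_zero (N : ℕ) : numMsg F 0 N = 1 := by simp [numMsg]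

theorem rpow_le_numMsg (R : ℝ) (N : ℕ) :
    (Fintype.card F : ℝ) ^ ((N : ℝ) * R) ≤ numMsg F R N := Nat.le_ceil _

theorem numMsg_le_rpow [Field F] {R : ℝ} (hR : 0 ≤ R) (N : ℕ) :
    (numMsg F R N : ℝ) ≤ (Fintype.card F : ℝ) ^ ((N : ℝ) * R + 1) := by
  have hQ := two_le_card F
  have h1 : (1 : ℝ) ≤ (Fintype.card F : ℝ) ^ ((N : ℝ) * R) :=
    Real.one_le_rpow (by linarith) (by positivity)
  have h2 := (Nat.ceil_lt_add_one (zero_le_one.trans h1)).le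
  rw [Real.rpow_add_one (by linarith)]
  unfold numMsg
  nlinarith

theorem le_log_numMsg [Field F] (R : ℝ) (N : ℕ) :
    N * R * Real.log (Fintype.card F) ≤ Real.log (numMsg F R N) := by
  have hQ : (0 : ℝ) < Fintype.card F := by linarith [two_le_card F]
  rw [← Real.log_rpow hQ]
  exact Real.log_le_log (Real.rpow_pos_of_pos hQ _) (rpow_le_numMsg F R N)

theorem log_numMsg_le [Field F] {R : ℝ} (hR : 0 ≤ R) (N : ℕ) :
    Real.log (numMsg F R N) ≤ (N * R + 1) * Real.log (Fintype.card F) := by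
  have hQ : (0 : ℝ) < Fintype.card F := by linarith [two_le_card F]
  rw [← Real.log_rpow hQ]
  refine Real.log_le_log ?_ (numMsg_le_rpow F hR N)
  exact_mod_cast Nat.pos_of_ne_zero (NeZero.ne (numMsg F R N))

end NumMsg

theorem msgProb_nonneg {m₀ mL mM : ℕ} (E : Set (Fin 2 → Msg m₀ mL mM)) : 0 ≤ Code.msgProb E := by
  unfold Code.msgProb
  positivity

/-! ### Outer bounds on achievable rates, by letting the block length grow. -/

section Converse

variable {F : Type*} [Field F] [Fintype F] {M L n k : ℕ} {R₀ RL : ℝ}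

/-- A Fano error term, normalised by the block length. -/
theorem fano_term_le {N : ℕ} (hN : 0 < N) {e R l : ℝ} (he : 0 ≤ e) (c : ℝ) (hc : 0 ≤ c)
    (hl : l ≤ (N * R + c) * Real.log (Fintype.card F)) :
    Real.log 2 + e * l ≤ N * Real.log (Fintype.card F) * ((N : ℝ)⁻¹ + e * (R + c)) := by
  have hN' : (1 : ℝ) ≤ N := by exact_mod_cast hN
  have hlog := log_card_pos F
  have h2 : Real.log 2 ≤ Real.log (Fintype.card F) := Real.log_le_log (by norm_num) (two_le_card F)
  have h3 : l ≤ N * (R + c) * Real.log (Fintype.card F) := by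
    refine hl.trans (mul_le_mul_of_nonneg_right ?_ hlog.le)
    -- Since `N ≥ 1`, the rounding constant `c` is at most `N * c`.
    nlinarith
  have h4 := mul_le_mul_of_nonneg_left h3 he
  have h5 : N * Real.log (Fintype.card F) * ((N : ℝ)⁻¹ + e * (R + c)) =
      Real.log (Fintype.card F) + e * (N * (R + c) * Real.log (Fintype.card F)) := by
    field_simp
  rw [h5]
  linarith

theorem log_numMsg_add_le (h0 : 0 ≤ R₀) (hL : 0 ≤ RL) (N : ℕ) :
    Real.log (numMsg F R₀ N) + Real.log (numMsg F RL N * numMsg F 0 N) ≤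
      (N * (R₀ + RL) + 2) * Real.log (Fintype.card F) := by
  have h1 := log_numMsg_le F h0 N
  have h2 := log_numMsg_le F hL N
  rw [numMsg_zero, Nat.cast_one, mul_one]
  linarith

theorem Achievable.add_le (h : Achievable F M L n k R₀ RL 0) : RL + R₀ ≤ M * n := by
  obtain ⟨h0, hL, -, C, hC⟩ := h
  have hlog := log_card_pos F
  have hlim : Tendsto (fun N : ℕ => (M : ℝ) * n +
      ((N : ℝ)⁻¹ + (C N).errFree 0 * (R₀ + RL + 2))) atTop
      (𝓝 (M * n + (0 + 0 * (R₀ + RL + 2)))) :=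
    tendsto_const_nhds.add (tendsto_inv_atTop_nhds_zero_nat.add ((hC 0).2.2.mul_const _))
  rw [zero_mul, add_zero, add_zero] at hlim
  refine ge_of_tendsto hlim ((eventually_gt_atTop 0).mono fun N hN => ?_)
  have hN' : (0 : ℝ) < N := by exact_mod_cast hN
  have h1 := (C N).log_card_le 0
  have h2 := fano_term_le (F := F) (e := (C N).errFree 0) hN (msgProb_nonneg _) 2 (by norm_num)
    (log_numMsg_add_le h0 hL N)
  have h3 := le_log_numMsg F R₀ N
  have h4 := le_log_numMsg F RL N
  have h5 : (numMsg F RL N : ℝ) * numMsg F 0 N = numMsg F RL N := by simp [numMsg_zero]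
  rw [h5] at h1 h2
  refine le_of_mul_le_mul_left ?_ (mul_pos hN' hlog)
  linarith

theorem Achievable.weighted_le [NeZero M] (hLM : 2 * L ≤ M) (h : Achievable F M L n k R₀ RL 0) :
    M * RL + (M - L) * R₀ ≤ M * ((M - 2 * L) * n + L * (max n k + (n - k : ℕ))) := by
  obtain ⟨h0, hL, -, C, hC⟩ := h
  have hlog := log_card_pos F
  have hLM' : (0 : ℝ) ≤ M - L := by
    have : ((2 * L : ℕ) : ℝ) ≤ M := by exact_mod_cast hLM
    push_cast at this
    linarith [(Nat.cast_nonneg L : (0 : ℝ) ≤ L)]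
  have hlim : Tendsto (fun N : ℕ => 2 * ((M : ℝ) * ((M - 2 * L) * n +
      L * (max n k + (n - k : ℕ)))) +
      ∑ i : Fin 2, (∑ s : Fin M, ((N : ℝ)⁻¹ + (C N).errSome i (window L s) * (RL + 1)) +
        (M - L) * ((N : ℝ)⁻¹ + (C N).errFree i * (R₀ + RL + 2)))) atTop
      (𝓝 (2 * ((M : ℝ) * ((M - 2 * L) * n + L * (max n k + (n - k : ℕ)))) +
      ∑ i : Fin 2, (∑ s : Fin M, (0 + 0 * (RL + 1)) + (M - L) * (0 + 0 * (R₀ + RL + 2))))) := by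
    refine tendsto_const_nhds.add (tendsto_finsetSum _ fun i _ => Tendsto.add ?_ ?_)
    · refine tendsto_finsetSum _ fun s _ => tendsto_inv_atTop_nhds_zero_nat.add
        (((hC i).2.1 _ (card_window (by omega) s)).mul_const _)
    · exact (tendsto_inv_atTop_nhds_zero_nat.add ((hC i).2.2.mul_const _)).const_mul _
  simp only [zero_mul, add_zero, mul_zero, Finset.sum_const_zero] at hlim
  refine le_of_mul_le_mul_left
    (ge_of_tendsto hlim ((eventually_gt_atTop 0).mono fun N hN => ?_)) (two_pos)
  have hN' : (0 : ℝ) < N := by exact_mod_cast hN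
  refine le_of_mul_le_mul_left ?_ (mul_pos hN' hlog)
  have h1 := (C N).weighted_log_card_le hLM
  have h5 : (numMsg F RL N : ℝ) * numMsg F 0 N = numMsg F RL N := by simp [numMsg_zero]
  have hsum : ∑ i : Fin 2, (∑ s : Fin M, (Real.log 2 + (C N).errSome i (window L s) *
        Real.log (numMsg F RL N * numMsg F 0 N)) +
        (M - L) * (Real.log 2 + (C N).errFree i *
          (Real.log (numMsg F R₀ N) + Real.log (numMsg F RL N * numMsg F 0 N)))) ≤
      N * Real.log (Fintype.card F) *
      ∑ i : Fin 2, (∑ s : Fin M, ((N : ℝ)⁻¹ + (C N).errSome i (window L s) * (RL + 1)) +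
        (M - L) * ((N : ℝ)⁻¹ + (C N).errFree i * (R₀ + RL + 2))) := by
    rw [Finset.mul_sum]
    refine Finset.sum_le_sum fun i _ => ?_
    rw [mul_add (N * Real.log (Fintype.card F)), Finset.mul_sum, mul_left_comm]
    refine add_le_add (Finset.sum_le_sum fun s _ => ?_) (mul_le_mul_of_nonneg_left ?_ hLM')
    · refine fano_term_le hN (msgProb_nonneg _) 1 (by norm_num) ?_
      rw [h5]
      exact log_numMsg_le F hL N
    · exact fano_term_le hN (msgProb_nonneg _) 2 (by norm_num) (log_numMsg_add_le h0 hL N)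
  have h3 := mul_le_mul_of_nonneg_left (le_log_numMsg F R₀ N) hLM'
  have h4 := mul_le_mul_of_nonneg_left (le_log_numMsg F RL N) (Nat.cast_nonneg (α := ℝ) M)
  have h6 := h1.trans (add_le_add_right hsum _)
  rw [h5] at h6
  linarith

end Converse

/-! ### Zero-error coding scheme. -/

section Achievability

/-- The Gilbert–Varshamov bound for codes of length `M` that correct `L` erasures. -/
theorem exists_erasure_code (A : Type*) [Fintype A] [Nonempty A] (M L : ℕ) :
    ∃ K : Finset (Fin M → A),
      (∀ S : Finset (Fin M), S.card = L → ∀ x ∈ K, ∀ y ∈ K, (∀ j ∉ S, x j = y j) → x = y) ∧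
      Fintype.card A ^ M ≤ K.card * (2 ^ M * Fintype.card A ^ L) := by
  classical
  set good : Finset (Fin M → A) → Prop := fun K =>
    ∀ S : Finset (Fin M), S.card = L → ∀ x ∈ K, ∀ y ∈ K, (∀ j ∉ S, x j = y j) → x = y with hgood
  obtain ⟨K, hK, hmax⟩ := (Finset.univ.filter good).exists_max_image Finset.card
    ⟨∅, by simp [hgood]⟩
  have hKg : good K := by simpa using hK
  refine ⟨K, hKg, ?_⟩
  have hball : ∀ (y : Fin M → A) (S : Finset (Fin M)), S.card = L →
      (Finset.univ.filter fun x : Fin M → A => ∀ j ∉ S, x j = y j).card ≤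
        Fintype.card A ^ L := by
    intro y S hS
    calc _ ≤ Fintype.card (S → A) := by
          refine Finset.card_le_card_of_injOn (fun x (j : S) => x j) (by simp) ?_
            |>.trans (le_of_eq Finset.card_univ)
          intro x hx x' hx' hxx
          simp only [Finset.coe_filter, Finset.mem_univ, true_and, Set.mem_ofPred_eq] at hx hx'
          funext j
          by_cases hj : j ∈ S
          · exact congrFun hxx ⟨j, hj⟩
          · rw [hx j hj, hx' j hj]
      _ = _ := by simp [hS]
  -- If `L > M` there are no `L`-sets to respect, and a nonempty code is large enough.
  by_cases hLM : L ≤ M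
  swap
  · have hM : (0 : ℕ) < K.card := by
      rw [Finset.card_pos]
      by_contra hne
      rw [Finset.not_nonempty_iff_eq_empty] at hne
      have := hmax {Classical.arbitrary _} (by simp [hgood])
      rw [hne] at this
      simp at this
    calc Fintype.card A ^ M ≤ Fintype.card A ^ L := Nat.pow_le_pow_right Fintype.card_pos (by omega)
      _ ≤ 2 ^ M * Fintype.card A ^ L := Nat.le_mul_of_pos_left _ (by positivity)
      _ ≤ _ := Nat.le_mul_of_pos_left _ hM
  -- By maximality of `K`, every word agrees with some codeword off some `L`-set, as otherwise it
  -- could be added to `K`.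
  have hcover : (Finset.univ : Finset (Fin M → A)) ⊆ K.biUnion fun y =>
      (Finset.univ.powersetCard L).biUnion fun S =>
        Finset.univ.filter fun x : Fin M → A => ∀ j ∉ S, x j = y j := by
    intro x _
    simp only [Finset.mem_biUnion, Finset.mem_powersetCard, Finset.mem_filter, Finset.mem_univ,
      true_and, Finset.subset_univ]
    by_cases hx : x ∈ K
    · obtain ⟨S, hS⟩ := Finset.exists_subset_card_eq (s := (Finset.univ : Finset (Fin M)))
        (n := L) (by simpa using hLM)
      exact ⟨x, hx, S, hS.2, fun _ _ => rfl⟩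
    by_contra hcon
    push Not at hcon
    have hins : good (insert x K) := by
      intro S hS a ha b hb hab
      rw [Finset.mem_insert] at ha hb
      rcases ha with rfl | ha <;> rcases hb with rfl | hb
      · rfl
      · obtain ⟨j, hj, hne⟩ := hcon b hb S hS
        exact absurd (hab j hj) hne
      · obtain ⟨j, hj, hne⟩ := hcon a ha S hS
        exact absurd (hab j hj).symm hne
      · exact hKg S hS a ha b hb hab
    have := hmax (insert x K) (by simpa using hins)
    rw [Finset.card_insert_of_notMem hx] at this
    omega
  calc Fintype.card A ^ M = (Finset.univ : Finset (Fin M → A)).card := by simp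
    _ ≤ _ := Finset.card_le_card hcover
    _ ≤ K.card * (2 ^ M * Fintype.card A ^ L) := by
        refine Finset.card_biUnion_le_card_mul _ _ _ fun y _ => ?_
        refine (Finset.card_biUnion_le_card_mul _ _ _ fun S hS =>
          hball y S (Finset.mem_powersetCard.1 hS).2).trans ?_
        refine Nat.mul_le_mul_right _ ?_
        rw [Finset.card_powersetCard, Finset.card_univ, Fintype.card_fin]
        exact Nat.choose_le_two_pow _ _

/-- The signal levels that a receiver sees split into `min k (2 * n - k)` levels which
interference may corrupt and the remaining ones, which it cannot corrupt as long as the lower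
levels of the other user are silent. -/
theorem exists_level_equiv {n k : ℕ} (hk : k ≤ 2 * n) :
    ∃ e : Fin (min k (2 * n - k)) ⊕ Fin (n - min k (2 * n - k)) ≃ Fin n,
      ∀ v, (max n k - n + (e (Sum.inr v) : ℕ) < max n k - k) ∨
        n + (max n k - k) ≤ max n k - n + (e (Sum.inr v) : ℕ) := by
  rcases le_total k n with h | h
  · have hmin : min k (2 * n - k) = k := by omega
    refine ⟨(Equiv.sumComm _ _).trans (finSumFinEquiv.trans (finCongr (by omega))), fun v => ?_⟩
    left
    simp only [Equiv.trans_apply, Equiv.sumComm_apply, Sum.swap_inr, finSumFinEquiv_apply_left,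
      finCongr_apply, Fin.val_cast, Fin.val_castAdd]
    omega
  · have hmin : min k (2 * n - k) = 2 * n - k := by omega
    refine ⟨finSumFinEquiv.trans (finCongr (by omega)), fun v => ?_⟩
    right
    simp only [Equiv.trans_apply, finSumFinEquiv_apply_right,
      finCongr_apply, Fin.val_cast, Fin.val_natAdd]
    omega

theorem exists_decoder {Ω β γ : Type*} [Nonempty β] (Y : Ω → γ) (W : Ω → β)
    (h : ∀ a b, Y a = Y b → W a = W b) : ∃ g : γ → β, ∀ ω, g (Y ω) = W ω :=
  ⟨Function.extend Y W fun _ => Classical.arbitrary β,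
    fun ω => Function.FactorsThrough.extend_apply (fun {_ _} hab => h _ _ hab) _ ω⟩

/-- A code meets all its decoding requirements without error. -/
def Code.ZeroError {F : Type*} [Field F] {M n k N m₀ mL mM : ℕ} (C : Code F M n k N m₀ mL mM)
    (L : ℕ) : Prop :=
  ∀ i, C.errAll i = 0 ∧ (∀ S : Finset (Fin M), S.card = L → C.errSome i S = 0) ∧ C.errFree i = 0

theorem msgProb_eq_zero {m₀ mL mM : ℕ} {E : Set (Fin 2 → Msg m₀ mL mM)} (h : ∀ w, w ∉ E) :
    Code.msgProb E = 0 := by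
  rw [Set.eq_empty_of_forall_notMem h]
  simp [Code.msgProb]

section Scheme

variable {F : Type*} [Field F] {M n k N m₀ mL : ℕ}

/-- `φ` is the content of the top `n` levels, `Sum.inl` exposed and `Sum.inr` safe; `hφ` says that
W_L survives the loss of the exposed levels on any `L` subcarriers. Lower levels stay silent, which
keeps the safe ones clean when `k > n`. -/
theorem exists_zeroError_code_of_content [NeZero m₀] [NeZero mL] (hk : k ≤ 2 * n) (L : ℕ)
    (φ : Fin m₀ × Fin mL → Fin N → Fin M →
      Fin (min k (2 * n - k)) ⊕ Fin (n - min k (2 * n - k)) → F)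
    (hinj : Function.Injective φ)
    (hφ : ∀ S : Finset (Fin M), S.card = L → ∀ w w' : Fin m₀ × Fin mL,
      (∀ t j v, φ w t j (Sum.inr v) = φ w' t j (Sum.inr v)) →
      (∀ t, ∀ j ∉ S, φ w t j = φ w' t j) → w.2 = w'.2) :
    ∃ C : Code F M n k N m₀ mL 1, C.ZeroError L := by
  classical
  obtain ⟨e, he⟩ := exists_level_equiv hk
  set x : Msg m₀ mL 1 → Signal F M n k N := fun w t j l =>
    if h : (l : ℕ) < n then φ (w.1, w.2.1) t j (e.symm ⟨l, h⟩) else 0 with hx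
  have hown : ∀ (w : Msg m₀ mL 1) t j u,
      ((shift F (max n k) ^ (max n k - n)) *ᵥ (x w t j))
        ⟨max n k - n + (e u : ℕ), by omega⟩ = φ (w.1, w.2.1) t j u := by
    intro w t j u
    rw [shift_pow_mulVec_apply, dif_pos (by simp)]
    simp [hx]
  have hsilent : ∀ (w : Msg m₀ mL 1) t j v,
      ((shift F (max n k) ^ (max n k - k)) *ᵥ (x w t j))
        ⟨max n k - n + (e (Sum.inr v) : ℕ), by omega⟩ = 0 := by
    intro w t j v
    rw [shift_pow_mulVec_apply]
    split_ifs with h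
    · simp only [hx]
      rw [dif_neg]
      have := he v
      simp only [] at h ⊢
      omega
    · rfl
  have hfree : ∀ i : Fin 2, ∃ g : Signal F M n k N → Msg m₀ mL 1, ∀ w : Fin 2 → Msg m₀ mL 1,
      g (received ∅ (x (w i)) (x (w i.rev))) = w i := by
    intro i
    refine exists_decoder _ (fun w : Fin 2 → Msg m₀ mL 1 => w i) fun a b hab => ?_
    have h : ((a i).1, (a i).2.1) = ((b i).1, (b i).2.1) := by
      refine hinj ?_
      funext t j u
      have h1 := congrFun (congrFun (congrFun hab t) j)
        ⟨max n k - n + (e u : ℕ), by omega⟩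
      simp only [received, Finset.notMem_empty, if_false] at h1
      rwa [hown, hown] at h1
    rw [Prod.mk.injEq] at h
    exact Prod.ext h.1 (Prod.ext h.2 (Subsingleton.elim _ _))
  have hsome : ∀ (i : Fin 2) (S : Finset (Fin M)), ∃ g : Signal F M n k N → Fin mL × Fin 1,
      S.card = L → ∀ w : Fin 2 → Msg m₀ mL 1,
      g (received S (x (w i)) (x (w i.rev))) = (w i).2 := by
    intro i S
    by_cases hS : S.card = L
    swap
    · exact ⟨fun _ => 0, fun h => absurd h hS⟩
    obtain ⟨g, hg⟩ := exists_decoder (fun w : Fin 2 → Msg m₀ mL 1 =>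
      received S (x (w i)) (x (w i.rev))) (fun w => (w i).2) (by
        intro a b hab
        refine Prod.ext (hφ S hS ((a i).1, (a i).2.1) ((b i).1, (b i).2.1) ?_ ?_)
          (Subsingleton.elim _ _)
        · intro t j v
          have h1 := congrFun (congrFun (congrFun hab t) j)
            ⟨max n k - n + (e (Sum.inr v) : ℕ), by omega⟩
          by_cases hj : j ∈ S
          · simp only [received, if_pos hj, Pi.add_apply] at h1
            rwa [hown, hown, hsilent, hsilent, add_zero, add_zero] at h1
          · simp only [received, if_neg hj] at h1
            rwa [hown, hown] at h1
        · intro t j hj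
          funext u
          have h1 := congrFun (congrFun (congrFun hab t) j)
            ⟨max n k - n + (e u : ℕ), by omega⟩
          simp only [received, if_neg hj] at h1
          rwa [hown, hown] at h1)
    exact ⟨g, fun _ => hg⟩
  choose gf hgf using hfree
  choose gs hgs using hsome
  refine ⟨⟨fun _ => x, fun _ _ => 0, gs, gf⟩, fun i => ⟨?_, fun S hS => ?_, ?_⟩⟩
  · exact msgProb_eq_zero fun w hw => hw (Subsingleton.elim _ _)
  · exact msgProb_eq_zero fun w hw => hw (hgs i S hS w)
  · exact msgProb_eq_zero fun w hw => hw (hgf i w)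

/-- W_L occupies `b` safe symbols in all and the same `a` exposed positions `P` on every subcarrier,
the latter as one letter of an erasure code over `P → F`. The factor `|F| ^ M` pays for the
Gilbert–Varshamov loss `2 ^ M`, which does not grow with `N`. The alternative `mL = 1` covers rate
zero, where there is no slack. -/
theorem exists_zeroError_code [Fintype F] [NeZero m₀] [NeZero mL] (hk : k ≤ 2 * n) {L a b : ℕ}
    (hLM : L ≤ M) (ha : a ≤ N * min k (2 * n - k)) (hb : b ≤ M * (N * (n - min k (2 * n - k))))
    (h₀ : m₀ ≤ Fintype.card F ^
      (M * (N * min k (2 * n - k) - a) + (M * (N * (n - min k (2 * n - k))) - b)))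
    (hmL : mL = 1 ∨ mL * Fintype.card F ^ M ≤ Fintype.card F ^ (b + a * (M - L))) :
    ∃ C : Code F M n k N m₀ mL 1, C.ZeroError L := by
  classical
  set d := min k (2 * n - k)
  set Q := Fintype.card F
  have hQ : 2 ≤ Q := Fintype.one_lt_card
  obtain ⟨P, -, hP⟩ := Finset.exists_subset_card_eq
    (s := (Finset.univ : Finset (Fin N × Fin d))) (n := a) (by simpa using ha)
  obtain ⟨B, -, hB⟩ := Finset.exists_subset_card_eq
    (s := (Finset.univ : Finset (Fin M × Fin N × Fin (n - d)))) (n := b) (by simpa using hb)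
  obtain ⟨K, hK, hKcard⟩ := exists_erasure_code (P → F) M L
  have hKA : Fintype.card (P → F) = Q ^ a := by simp [hP, Q]
  rw [hKA] at hKcard
  have hmL' : mL ≤ Q ^ b * K.card := by
    have hKpos : 0 < K.card := by
      by_contra h0
      have : K.card = 0 := by omega
      rw [this, zero_mul] at hKcard
      have : 0 < (Q ^ a) ^ M := by positivity
      omega
    rcases hmL with rfl | hmL
    · exact Nat.mul_pos (by positivity) hKpos
    · have h1 : mL * (2 ^ M * (Q ^ a) ^ L) ≤ Q ^ b * K.card * (2 ^ M * (Q ^ a) ^ L) := by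
        calc mL * (2 ^ M * (Q ^ a) ^ L) ≤ mL * (Q ^ M * (Q ^ a) ^ L) :=
              Nat.mul_le_mul_left _ (Nat.mul_le_mul_right _ (Nat.pow_le_pow_left hQ M))
          _ = mL * Q ^ M * (Q ^ a) ^ L := by ring
          _ ≤ Q ^ (b + a * (M - L)) * (Q ^ a) ^ L := Nat.mul_le_mul_right _ hmL
          _ = Q ^ b * (Q ^ a) ^ M := by
              rw [← pow_mul, ← pow_mul, ← pow_add, ← pow_add, add_assoc, ← mul_add,
                Nat.sub_add_cancel hLM]
          _ ≤ Q ^ b * (K.card * (2 ^ M * (Q ^ a) ^ L)) := Nat.mul_le_mul_left _ hKcard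
          _ = _ := by ring
      exact Nat.le_of_mul_le_mul_right h1 (by positivity)
  have hcP : Fintype.card {p : Fin N × Fin d // p ∉ P} = N * d - a := by
    rw [Fintype.card_subtype_compl]
    simp [hP]
  have hcB : Fintype.card {p : Fin M × Fin N × Fin (n - d) // p ∉ B} =
      M * (N * (n - d)) - b := by
    rw [Fintype.card_subtype_compl]
    simp [hB]
  obtain ⟨f₀⟩ : Nonempty (Fin m₀ ↪ (Fin M × {p : Fin N × Fin d // p ∉ P} → F) ×
      ({p : Fin M × Fin N × Fin (n - d) // p ∉ B} → F)) := by
    refine Function.Embedding.nonempty_of_card_le ?_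
    rw [Fintype.card_fin, Fintype.card_prod, Fintype.card_fun, Fintype.card_fun,
      Fintype.card_prod, hcP, hcB, Fintype.card_fin, ← pow_add]
    exact h₀
  obtain ⟨fL⟩ : Nonempty (Fin mL ↪ (B → F) × K) := by
    refine Function.Embedding.nonempty_of_card_le ?_
    rw [Fintype.card_fin, Fintype.card_prod, Fintype.card_fun, Fintype.card_coe,
      Fintype.card_coe, hB]
    exact hmL'
  set φ : Fin m₀ × Fin mL → Fin N → Fin M → Fin d ⊕ Fin (n - d) → F := fun w t j =>
    Sum.elim
      (fun u => if h : (t, u) ∈ P then ((fL w.2).2 : Fin M → P → F) j ⟨(t, u), h⟩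
        else (f₀ w.1).1 (j, ⟨(t, u), h⟩))
      (fun v => if h : (j, t, v) ∈ B then (fL w.2).1 ⟨(j, t, v), h⟩
        else (f₀ w.1).2 ⟨(j, t, v), h⟩) with hφdef
  have hφ : ∀ S : Finset (Fin M), S.card = L → ∀ w w' : Fin m₀ × Fin mL,
      (∀ t j v, φ w t j (Sum.inr v) = φ w' t j (Sum.inr v)) →
      (∀ t, ∀ j ∉ S, φ w t j = φ w' t j) → w.2 = w'.2 := by
    intro S hS w w' h1 h2
    refine fL.injective (Prod.ext ?_ (Subtype.ext ?_))
    · funext p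
      obtain ⟨⟨j, t, v⟩, hp⟩ := p
      have := h1 t j v
      simpa [hφdef, hp] using this
    · refine hK S hS _ (fL w.2).2.2 _ (fL w'.2).2.2 fun j hj => ?_
      funext p
      obtain ⟨⟨t, u⟩, hp⟩ := p
      have := congrFun (h2 t j hj) (Sum.inl u)
      simpa [hφdef, hp] using this
  refine exists_zeroError_code_of_content hk L φ ?_ hφ
  intro w w' hww
  -- Any `L`-set will do: equal contents agree off `S` too, so `hφ` yields W_L.
  obtain ⟨S, -, hS⟩ := Finset.exists_subset_card_eq (s := (Finset.univ : Finset (Fin M)))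
    (n := L) (by simpa using hLM)
  refine Prod.ext (f₀.injective (Prod.ext ?_ ?_))
    (hφ S hS w w' (fun t j v => by rw [hww]) fun t j _ => by rw [hww])
  · funext p
    obtain ⟨j, ⟨t, u⟩, hp⟩ := p
    have := congrFun (congrFun (congrFun hww t) j) (Sum.inl u)
    simpa [hφdef, hp] using this
  · funext p
    obtain ⟨⟨j, t, v⟩, hp⟩ := p
    have := congrFun (congrFun (congrFun hww t) j) (Sum.inr v)
    simpa [hφdef, hp] using this

end Scheme

end Achievability

/-! ### From the scheme to the rate region. -/

section Region

variable {F : Type*} [Field F] [Fintype F]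

theorem numMsg_mul_pow_le {R : ℝ} (hR : 0 ≤ R) {N m E : ℕ} (h : N * R + 1 + m ≤ (E : ℝ)) :
    numMsg F R N * Fintype.card F ^ m ≤ Fintype.card F ^ E := by
  have hQ : (0 : ℝ) < Fintype.card F := by linarith [two_le_card F]
  have h1 : (numMsg F R N : ℝ) * (Fintype.card F : ℝ) ^ m ≤ (Fintype.card F : ℝ) ^ E := by
    calc _ ≤ (Fintype.card F : ℝ) ^ ((N : ℝ) * R + 1) * (Fintype.card F : ℝ) ^ (m : ℝ) := by
          rw [Real.rpow_natCast]
          exact mul_le_mul_of_nonneg_right (numMsg_le_rpow F hR N) (by positivity)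
      _ = (Fintype.card F : ℝ) ^ ((N : ℝ) * R + 1 + m) := (Real.rpow_add hQ _ _).symm
      _ ≤ (Fintype.card F : ℝ) ^ (E : ℝ) :=
          Real.rpow_le_rpow_of_exponent_le (by linarith [two_le_card F]) h
      _ = _ := Real.rpow_natCast _ _
  exact_mod_cast h1

theorem achievable_of_eventually {M L n k : ℕ} {R₀ RL : ℝ} (h0 : 0 ≤ R₀) (hL : 0 ≤ RL)
    (h : ∀ᶠ N in atTop, ∃ C : Code F M n k N (numMsg F R₀ N) (numMsg F RL N) 1, C.ZeroError L) :
    Achievable F M L n k R₀ RL 0 := by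
  obtain ⟨N₀, hN₀⟩ := eventually_atTop.1 h
  have hex : ∀ N : ℕ, ∃ C : Code F M n k N (numMsg F R₀ N) (numMsg F RL N) (numMsg F 0 N),
      N₀ ≤ N → C.ZeroError L := by
    intro N
    by_cases hN : N₀ ≤ N
    · rw [numMsg_zero]
      obtain ⟨C, hC⟩ := hN₀ N hN
      exact ⟨C, fun _ => hC⟩
    · exact ⟨⟨fun _ _ => 0, fun _ _ => 0, fun _ _ _ => 0, fun _ _ => 0⟩, fun h => absurd h hN⟩
  choose C hC using hex
  refine ⟨h0, hL, le_rfl, C, fun i => ⟨?_, fun S hS => ?_, ?_⟩⟩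
  · exact tendsto_const_nhds.congr' ((eventually_ge_atTop N₀).mono fun N hN => (hC N hN i).1.symm)
  · exact tendsto_const_nhds.congr'
      ((eventually_ge_atTop N₀).mono fun N hN => ((hC N hN i).2.1 S hS).symm)
  · exact tendsto_const_nhds.congr'
      ((eventually_ge_atTop N₀).mono fun N hN => (hC N hN i).2.2.symm)

/-- Any fixed fraction of a rate pair is achievable when the pair is supported by a share `s` of
erasure-coded levels per subcarrier and `u` interference-free symbols for `W_L` per channel
use. -/
theorem achievable_mul {M L n k : ℕ} (hk : k ≤ 2 * n) (hLM : L ≤ M) {R₀ RL s u δ : ℝ}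
    (h0 : 0 ≤ R₀) (hL : 0 ≤ RL) (hs : 0 ≤ s) (hu : 0 ≤ u)
    (hsd : s ≤ (min k (2 * n - k) : ℕ)) (hud : u ≤ M * (n - min k (2 * n - k) : ℕ))
    (hRL : RL ≤ u + (M - L) * s) (hR₀ : R₀ + M * s + u ≤ M * n) (hδ : 0 < δ) (hδ1 : δ ≤ 1) :
    Achievable F M L n k ((1 - δ) * R₀) ((1 - δ) * RL) 0 := by
  have h1δ : 0 ≤ 1 - δ := sub_nonneg.2 hδ1
  have h0' : 0 ≤ (1 - δ) * R₀ := mul_nonneg h1δ h0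
  have hL' : 0 ≤ (1 - δ) * RL := mul_nonneg h1δ hL
  refine achievable_of_eventually h0' hL' ?_
  have hlarge : ∀ (R c : ℝ), 0 ≤ R → R = 0 ∨ ∀ᶠ N : ℕ in atTop, c ≤ N * (δ * R) := by
    intro R c hR
    rcases hR.eq_or_lt with h | h
    · exact Or.inl h.symm
    · exact Or.inr ((tendsto_natCast_atTop_atTop.atTop_mul_const
        (mul_pos hδ h)).eventually_ge_atTop c)
  have hev₀ : ∀ᶠ N : ℕ in atTop, R₀ = 0 ∨ 1 ≤ N * (δ * R₀) := by
    rcases hlarge R₀ 1 h0 with h | h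
    · exact Eventually.of_forall fun _ => Or.inl h
    · exact h.mono fun _ => Or.inr
  -- The slack covers 1 for the ceiling in `numMsg`, `M` for the erasure code, 1 for rounding `b`
  -- and `M - L` for rounding `a`.
  have hevL : ∀ᶠ N : ℕ in atTop, RL = 0 ∨ (2 + 2 * M : ℝ) ≤ N * (δ * RL) := by
    rcases hlarge RL (2 + 2 * M) hL with h | h
    · exact Eventually.of_forall fun _ => Or.inl h
    · exact h.mono fun _ => Or.inr
  filter_upwards [hev₀, hevL] with N hN₀ hNL
  set d := min k (2 * n - k)
  have hdn : d ≤ n := by omega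
  have hN : (0 : ℝ) ≤ N := Nat.cast_nonneg N
  have hM : (0 : ℝ) ≤ M := Nat.cast_nonneg M
  have hLM' : (L : ℝ) ≤ M := by exact_mod_cast hLM
  have ha1 := Nat.floor_le (mul_nonneg hN hs)
  have ha2 := Nat.sub_one_lt_floor ((N : ℝ) * s)
  have hb1 := Nat.floor_le (mul_nonneg hN hu)
  have hb2 := Nat.sub_one_lt_floor ((N : ℝ) * u)
  set a := ⌊(N : ℝ) * s⌋₊
  set b := ⌊(N : ℝ) * u⌋₊
  have ha : a ≤ N * d := by
    have : (a : ℝ) ≤ N * d := ha1.trans (mul_le_mul_of_nonneg_left hsd hN)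
    exact_mod_cast this
  have hb : b ≤ M * (N * (n - d)) := by
    have : (b : ℝ) ≤ N * (M * (n - d : ℕ)) := hb1.trans (mul_le_mul_of_nonneg_left hud hN)
    have h : b ≤ N * (M * (n - d)) := by exact_mod_cast this
    rwa [mul_left_comm] at h
  refine exists_zeroError_code hk hLM ha hb ?_ ?_
  · rcases hN₀ with h | h
    · rw [h, mul_zero, numMsg_zero]
      exact Nat.one_le_pow _ _ Fintype.card_pos
    · have := numMsg_mul_pow_le (F := F) h0' (N := N) (m := 0)
        (E := M * (N * d - a) + (M * (N * (n - d)) - b)) (by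
          push_cast [Nat.cast_sub ha, Nat.cast_sub hb, Nat.cast_sub hdn]
          have e1 := mul_le_mul_of_nonneg_left hR₀ hN
          have e2 := mul_le_mul_of_nonneg_left ha1 hM
          linarith)
      simpa using this
  · rcases hNL with h | h
    · left
      rw [h, mul_zero, numMsg_zero]
    · right
      refine numMsg_mul_pow_le hL' ?_
      push_cast [Nat.cast_sub hLM]
      have e1 := mul_le_mul_of_nonneg_left hRL hN
      have e2 := mul_le_mul_of_nonneg_right ha2.le (sub_nonneg.2 hLM')
      have e3 : (0 : ℝ) ≤ L := Nat.cast_nonneg L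
      linarith

/-- W_L uses the safe levels first. Any excess over `M * (n - d)` goes to the exposed levels, where
a share `s` on all `M` subcarriers carries only `(M - L) * s`. The room then left for W_0 is exactly
the weighted bound; dropping `R₀` from that bound gives `s ≤ d`. -/
theorem exists_level_shares {M L n d : ℕ} (hdn : d ≤ n) (hLM : 2 * L ≤ M) {R₀ RL : ℝ}
    (h0 : 0 ≤ R₀) (hL : 0 ≤ RL)
    (h1 : M * RL + (M - L) * R₀ ≤ M * ((M - 2 * L) * n + L * (2 * n - d)))
    (h2 : RL + R₀ ≤ M * n) :
    ∃ s u : ℝ, 0 ≤ s ∧ 0 ≤ u ∧ s ≤ d ∧ u ≤ M * (n - d : ℕ) ∧ RL ≤ u + (M - L) * s ∧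
      R₀ + M * s + u ≤ M * n := by
  have hdn' : (0 : ℝ) ≤ n - d := sub_nonneg.2 (by exact_mod_cast hdn)
  rw [Nat.cast_sub hdn]
  rcases le_or_gt RL (M * (n - d)) with h | h
  · exact ⟨0, RL, le_rfl, hL, Nat.cast_nonneg d, h, by linarith, by linarith⟩
  · rcases Nat.eq_zero_or_pos M with rfl | hM
    · simp only [Nat.cast_zero, zero_mul] at h h2
      linarith
    have hML : (0 : ℝ) < M - L := sub_pos.2 (by exact_mod_cast (by omega : L < M))
    have hM' : (0 : ℝ) < M := by exact_mod_cast hM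
    have hs : (M - L) * ((RL - M * (n - d)) / (M - L)) = RL - M * (n - d) :=
      mul_div_cancel₀ _ hML.ne'
    set s := (RL - M * (n - d)) / (M - L)
    refine ⟨s, M * (n - d), ?_, mul_nonneg hM'.le hdn', ?_, le_rfl, by linarith, ?_⟩
    · exact div_nonneg (by linarith) hML.le
    · have e1 : (M : ℝ) * RL ≤ M * ((M - 2 * L) * n + L * (2 * n - d)) := by
        linarith [mul_nonneg hML.le h0]
      have e2 := le_of_mul_le_mul_left e1 hM'
      refine le_of_mul_le_mul_left ?_ hML
      rw [hs]
      linarith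
    · refine le_of_mul_le_mul_left ?_ hML
      have : (M - L) * (R₀ + M * s + M * (n - d)) =
          (M - L) * R₀ + M * ((M - L) * s) + (M - L) * (M * (n - d) : ℝ) := by ring
      rw [this, hs]
      linarith

end Region

end BurstyIC

/-! ### The capacity region. -/

theorem theorem1 (F : Type*) [Field F] [Fintype F] (M L n k : ℕ) (hL : (L : ℝ) ≤ (M : ℝ) / 2)
    (hn : 0 < n) (α : ℝ) (hα : α = (k : ℝ) / (n : ℝ)) (hα2 : α ≤ 2) :
    BurstyIC.capacityRegion F M L n k =
      {p : ℝ × ℝ | 0 ≤ p.1 ∧ 0 ≤ p.2 ∧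
        (M : ℝ) * p.2 + ((M : ℝ) - L) * p.1 ≤
          M * (((M : ℝ) - 2 * L) + L * (max 1 α + max (1 - α) 0)) * n ∧
        p.2 + p.1 ≤ (M : ℝ) * n} := by
  have hn' : (0 : ℝ) < n := by exact_mod_cast hn
  have hLM : 2 * L ≤ M := by
    have : (2 * L : ℝ) ≤ M := by linarith
    exact_mod_cast this
  have hαn : α * n = k := by rw [hα, div_mul_cancel₀ _ hn'.ne']
  have hk : k ≤ 2 * n := by
    have : (k : ℝ) ≤ 2 * n := by
      rw [← hαn]
      exact mul_le_mul_of_nonneg_right hα2 hn'.le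
    exact_mod_cast this
  have hmax : ((max n k : ℕ) : ℝ) + (n - k : ℕ) = (max 1 α + max (1 - α) 0) * n := by
    rw [add_mul, max_mul_of_nonneg _ _ hn'.le, max_mul_of_nonneg _ _ hn'.le, sub_mul, hαn, one_mul,
      zero_mul, Nat.cast_max]
    congr 1
    rcases le_total k n with h | h
    · rw [Nat.cast_sub h, max_eq_left (sub_nonneg.2 (by exact_mod_cast h))]
    · rw [Nat.sub_eq_zero_of_le h, Nat.cast_zero,
        max_eq_right (sub_nonpos.2 (by exact_mod_cast h))]
  have hbound : (M : ℝ) * (((M : ℝ) - 2 * L) + L * (max 1 α + max (1 - α) 0)) * n =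
      M * ((M - 2 * L) * n + L * (((max n k : ℕ) : ℝ) + (n - k : ℕ))) := by
    rw [hmax]
    ring
  rw [hbound]
  refine Set.Subset.antisymm (closure_minimal ?_ ?_) ?_
  · intro p hp
    refine ⟨hp.1, hp.2.1, ?_, hp.add_le⟩
    -- Cyclic windows need `M > 0`; for `M = 0` also `L = 0` and both sides vanish.
    rcases Nat.eq_zero_or_pos M with rfl | hM
    · have h0 : L = 0 := by omega
      simp [h0]
    · have : NeZero M := ⟨hM.ne'⟩
      exact hp.weighted_le hLM
  · exact ((isClosed_le continuous_const continuous_fst).inter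
      ((isClosed_le continuous_const continuous_snd).inter
      ((isClosed_le (f := fun p : ℝ × ℝ => (M : ℝ) * p.2 + ((M : ℝ) - L) * p.1) (by fun_prop)
        continuous_const).inter
      (isClosed_le (f := fun p : ℝ × ℝ => p.2 + p.1) (by fun_prop) continuous_const))))
  · rintro ⟨R₀, RL⟩ ⟨h0, hRL, h1, h2⟩
    -- The symbol count of the converse equals `2 * n - d` with `d` the number of exposed levels, so
    -- the two bounds meet; this uses `k ≤ 2 * n`.
    have hmin : ((max n k : ℕ) : ℝ) + (n - k : ℕ) = 2 * n - (min k (2 * n - k) : ℕ) := by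
      rw [eq_sub_iff_add_eq]
      exact_mod_cast (by omega : max n k + (n - k) + min k (2 * n - k) = 2 * n)
    rw [hmin] at h1
    obtain ⟨s, u, hs, hu, hsd, hud, hL1, hL2⟩ := BurstyIC.exists_level_shares
      (by omega : min k (2 * n - k) ≤ n) hLM h0 hRL h1 h2
    have hlim : Tendsto (fun δ : ℝ => ((1 - δ) * R₀, (1 - δ) * RL)) (𝓝[>] 0) (𝓝 (R₀, RL)) := by
      have : Continuous fun δ : ℝ => ((1 - δ) * R₀, (1 - δ) * RL) := by fun_prop
      simpa using (this.tendsto 0).mono_left nhdsWithin_le_nhds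
    refine mem_closure_of_tendsto hlim ?_
    filter_upwards [Ioc_mem_nhdsGT (zero_lt_one : (0 : ℝ) < 1)] with δ hδ
    exact BurstyIC.achievable_mul hk (by omega) h0 hRL hs hu hsd hud hL1 hL2 hδ.1 hδ.2
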